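/- Setting. Let $\mathcal P_0$ be a set of probability laws on a measurable space $\mathcal X$ (the null hypothesis), let $X=(X_1,\dots,X_n)\sim P^n$ be i.i.d. data and let $\Omega\sim P_\Omega$ be external randomness independent of $X$. For each $n$ let $T_n=(T_n^{(1)},\dots,T_n^{(L)})$, $L\ge 1$, be real statistics which are measurable functions of $(X_1,\dots,X_n,\Omega)$, and suppose that for every $P\in\mathcal P_0$ and $n\ge 1$ the vector $T_n$ is exchangeable under $P^n\times P_\Omega$. Suppose that $T_n^{(1)}\to_d F_0$ under every $P\in\mathcal P_0$, where $F_0$ is $\mathrm{unif}(0,1)$ or $\mathcal N(0,1)$. Let $S^1,\dots,S^W:\mathbb R^L\to\mathbb R$, $W\ge 1$, be aggregation functions, each $1$-Lipschitz with respect to $\|\cdot\|_\infty$, and put $S_n^w:=S^w(T_n^{(1)},\dots,T_n^{(L)})$. Write $\mathbb F_{\{x_i\}}$ for the empirical distribution function of points $x_i$, and $F^{-1}(p):=\inf\{x:F(x)\ge p\}$. The adaptive test. Let $J\ge1$ be a fixed integer and let $m=m(n)$ be a subsample size with $m\to\infty$ and $m/n\to0$ (for instance $m=\lfloor n/\log n\rfloor$);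 put $B:=J\lfloor n/m\rfloor$. Draw $J$ independent uniform permutations of $\{1,\dots,n\}$, independent of $X$ and of all external randomness, and cut each of them into $\lfloor n/m\rfloor$ consecutive disjoint blocks of length $m$; this gives $B$ subsamples. Let $\hat H_{b,\cdot}$ be the vector $(T_m^{(1)},\dots,T_m^{(L)})$ computed on the $b$-th subsample, the external randomness being regenerated independently for each subsample, independently of that used on the full sample. Let $$\tilde H_{b,l}:=F_0^{-1}\bigl(\mathbb F_{\hat{\mathbf H}}(\hat H_{b,l})-1/(2BL)\bigr),\qquad \tilde S_b^w:=S^w(\tilde H_{b,1},\dots,\tilde H_{b,L}),\qquad \tilde G_n^w:=\mathbb F_{\{\tilde S_b^w:\,b=1,\dots,B\}},$$ $$\tilde R_b:=\max_{w}\tilde G_n^w(\tilde S_b^w),\qquad \tilde Q_n:=\mathbb F_{\{\tilde R_b:\,b=1,\dots,B\}},\qquad R_n:=\max_{w}\tilde G_n^w(S_n^w),$$ where $\mathbb F_{\hat{\mathbf H}}$ is the empirical distribution function of all $BL$ entries of $\hat{\mathbf H}$. The test rejects when $R_n>\tilde Q_n^{-1}(1-\alpha)$. Theorem. For every $\alpha\in(0,1)$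 the following hold. (i) Suppose that for every $P\in\mathcal P_0$ the vector $(S_n^1,\dots,S_n^W)$ converges in distribution to a random vector each of whose coordinates has a bounded density with respect to Lebesgue measure. Then for every $P\in\mathcal P_0$, $$\mathbb P_P\{R_n>\tilde Q_n^{-1}(1-\alpha)\}\to\alpha .$$ (ii) Suppose that for every $P\in\mathcal P_0$ there are distribution functions $G_P^w$ $(w=1,\dots,W)$ with densities $g_P^w$, and a distribution function $Q_P$, such that $\max_w\sup_{P\in\mathcal P_0}\sup_x g_P^w(x)<\infty$ and, for every $x\in\mathbb R$ and every $w$, as $n\to\infty$, $$\sup_{P\in\mathcal P_0}|F_{n,P}(x)-F_0(x)|\to0,\qquad \sup_{P\in\mathcal P_0}|G^w_{n,P}(x)-G^w_P(x)|\to0,\qquad \sup_{P\in\mathcal P_0}|Q_{n,P}(x)-Q_P(x)|\to0,$$ where $F_{n,P}$, $G^w_{n,P}$ and $Q_{n,P}$ are the distribution functions, under $(X,\Omega)\sim P^n\times P_\Omega$, of $T_n^{(1)}$, $S_n^w$ and $\max\{G_P^1(S_n^1),\dots,G_P^W(S_n^W)\}$ respectively. Then $$\sup_{P\in\mathcal P_0}\bigl|\mathbb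 P_P\{R_n>\tilde Q_n^{-1}(1-\alpha)\}-\alpha\bigr|\to0 .$$ -/

import Mathlib

open MeasureTheory ProbabilityTheory Filter Topology
open scoped ENNReal NNReal

namespace RankSub

noncomputable section

/-! ### Empirical distribution functions and quantiles -/

/-- The empirical distribution function of the finite family of points `x`. -/
def ecdf {ι : Type*} [Fintype ι] (x : ι → ℝ) (t : ℝ) : ℝ :=
  ((Finset.univ.filter fun i => x i ≤ t).card : ℝ) / (Fintype.card ι : ℝ)

/-- The generalised inverse `F⁻¹(p) = inf {x : F x ≥ p}`. -/
def quantile (F : ℝ → ℝ) (p : ℝ) : ℝ := sInf {x | p ≤ F x}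

/-! ### The single-split statistics computed on the full sample -/

section Statistics

variable {𝒳 E : Type*} [MeasurableSpace 𝒳] [MeasurableSpace E]

/-- The law `P^n × P_Ω` of the iid data `X = (X₁, …, Xₙ)` and of the external randomness `Ω`. -/
def dataLaw (P : ProbabilityMeasure 𝒳) (PΩ : Measure E) (n : ℕ) :
    Measure ((Fin n → 𝒳) × E) :=
  (Measure.pi fun _ : Fin n => (P : Measure 𝒳)).prod PΩ

instance (P : ProbabilityMeasure 𝒳) (PΩ : Measure E) [IsProbabilityMeasure PΩ] (n : ℕ) :
    IsProbabilityMeasure (dataLaw P PΩ n) := by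
  unfold dataLaw; infer_instance

/-- Under `μ`, the random vector `(T 1, …, T L)` is exchangeable: permuting its coordinates
does not change its joint law. -/
def Exchangeable {Ω : Type*} [MeasurableSpace Ω] {L : ℕ} (μ : Measure Ω)
    (T : Ω → Fin L → ℝ) : Prop :=
  ∀ σ : Equiv.Perm (Fin L), μ.map (fun ω l => T ω (σ l)) = μ.map T

/-- The distribution function of the real random variable `Y` under `P^n × P_Ω`. -/
def distFun (P : ProbabilityMeasure 𝒳) (PΩ : Measure E) (n : ℕ)
    (Y : (Fin n → 𝒳) × E → ℝ) (x : ℝ) : ℝ :=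
  cdf ((dataLaw P PΩ n).map Y) x

/-- Joint stability of the aggregation functions `S¹, …, S^W` under `P`: the vector
`(Sₙ¹, …, Sₙ^W)` converges in distribution to a random vector, with law `ν` say, each coordinate
of which has a bounded Lebesgue density (in particular a continuous distribution function). -/
def JointlyStable (PΩ : Measure E) [IsProbabilityMeasure PΩ] {L W : ℕ}
    (T : ∀ n, (Fin n → 𝒳) × E → Fin L → ℝ) (S : Fin W → (Fin L → ℝ) → ℝ)
    (P : ProbabilityMeasure 𝒳) : Prop :=
  ∃ ν : ProbabilityMeasure (Fin W → ℝ),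
    TendstoInDistribution (fun n ω w => S w (T n ω)) atTop (id : (Fin W → ℝ) → Fin W → ℝ)
      (fun n => dataLaw P PΩ n) (ν : Measure (Fin W → ℝ)) ∧
    ∀ w, ∃ g : ℝ → ℝ≥0∞, Measurable g ∧
      (ν : Measure (Fin W → ℝ)).map (fun s => s w) = volume.withDensity g ∧
      ∃ C : ℝ≥0, ∀ x, g x ≤ C

end Statistics

/-! ### Subsampling -/

/-- The finite set of permutations of `{1, …, n}` carries the discrete σ-algebra. -/
instance permMeasurableSpace (n : ℕ) : MeasurableSpace (Equiv.Perm (Fin n)) := ⊤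

/-- The `i`-th index of the `k`-th consecutive block of length `m` of the permutation `π`, i.e.
`π (k m + i)` with all indices counted from `0`. -/
def blockIndex {n m : ℕ} (π : Equiv.Perm (Fin n)) (k : Fin (n / m)) (i : Fin m) : Fin n :=
  π ⟨k * m + i, by
    calc (k : ℕ) * m + i < k * m + m := by have := i.isLt; omega
      _ = (k + 1) * m := by ring
      _ ≤ n / m * m := Nat.mul_le_mul_right m k.isLt
      _ ≤ n := Nat.div_mul_le_self n m⟩

/-- The index set of the `B = J ⌊n/m⌋` subsamples: `(j, k)` is the `k`-th block of the `j`-th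
permutation. -/
abbrev Rows (J n m : ℕ) : Type := Fin J × Fin (n / m)

/-- All random inputs of the procedure: the data, the external randomness used on the full sample,
the external randomness used on each of the subsamples, and the `J` permutations. -/
abbrev Inputs (𝒳 E : Type*) (J n m : ℕ) : Type _ :=
  ((Fin n → 𝒳) × E) × (Rows J n m → E) × (Fin J → Equiv.Perm (Fin n))

/-- The law of the random inputs: the data are iid from `P`, the external randomness is regenerated
independently for every subsample, the permutations are independent and uniform, and these are
independent of each other. -/
def inputLaw {𝒳 E : Type*} [MeasurableSpace 𝒳] [MeasurableSpace E]
    (P : ProbabilityMeasure 𝒳) (PΩ : Measure E) (J n m : ℕ) : Measure (Inputs 𝒳 E J n m) :=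
  (dataLaw P PΩ n).prod
    ((Measure.pi fun _ : Rows J n m => PΩ).prod
      (Measure.pi fun _ : Fin J => (PMF.uniformOfFintype (Equiv.Perm (Fin n))).toMeasure))

/-- The matrix `Ĥ` of the single-split statistics computed on the subsamples. -/
def subsampleMatrix {𝒳 E : Type*} {J n m L : ℕ} (Tm : (Fin m → 𝒳) × E → Fin L → ℝ)
    (I : Inputs 𝒳 E J n m) : Rows J n m → Fin L → ℝ :=
  fun b => Tm (fun i => I.1.1 (blockIndex (I.2.2 b.1) b.2 i), I.2.1 b)

/-! ### The adaptive test based on the rank-transformed subsampling matrix -/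

section Adaptive

variable {ι : Type*} [Fintype ι] {L W : ℕ}

/-- The rank transform `H̃ b l = F₀⁻¹(F(H b l) - 1 / (2 B L))`, with `F` the empirical distribution
function of all the entries of the `B × L` matrix `H`. -/
def rankTransform (F₀ : ℝ → ℝ) (H : ι → Fin L → ℝ) (b : ι) (l : Fin L) : ℝ :=
  quantile F₀ (ecdf (fun p : ι × Fin L => H p.1 p.2) (H b l)
    - 1 / (2 * (Fintype.card ι : ℝ) * (L : ℝ)))

/-- `G̃ʷ`, the empirical distribution function of the aggregated statistics
`S̃ᵇ = Sʷ(H̃ b 1, …, H̃ b L)`. -/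
def aggEcdf (S : Fin W → (Fin L → ℝ) → ℝ) (Ht : ι → Fin L → ℝ) (w : Fin W) : ℝ → ℝ :=
  ecdf fun b => S w (Ht b)

variable [NeZero W]

/-- `max (G¹(S¹(t)), …, G^W(S^W(t)))` for the vector `t` of single-split statistics. -/
def maxStat (G : Fin W → ℝ → ℝ) (S : Fin W → (Fin L → ℝ) → ℝ) (t : Fin L → ℝ) : ℝ :=
  Finset.univ.sup' Finset.univ_nonempty fun w => G w (S w t)

/-- `Q̃`, the empirical distribution function of
`R̃ b = max (G̃¹(S̃¹ b), …, G̃^W(S̃^W b))`. -/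
def adaptiveEcdf (S : Fin W → (Fin L → ℝ) → ℝ) (Ht : ι → Fin L → ℝ) : ℝ → ℝ :=
  ecdf fun b => maxStat (aggEcdf S Ht) S (Ht b)

/-- The adaptive test rejects: `R > Q̃⁻¹(1 - α)` with `R = max (G̃¹(S¹(t)), …, G̃^W(S^W(t)))`,
where `t` is the vector of statistics on the full sample and `H` the subsampling matrix. -/
def AdaptiveRejects (F₀ : ℝ → ℝ) (S : Fin W → (Fin L → ℝ) → ℝ) (α : ℝ)
    (t : Fin L → ℝ) (H : ι → Fin L → ℝ) : Prop :=
  quantile (adaptiveEcdf S (rankTransform F₀ H)) (1 - α)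
    < maxStat (aggEcdf S (rankTransform F₀ H)) S t

end Adaptive

/-- The probability, when the data are iid from `P`, that the adaptive test with sample size `n` and
subsample size `m` rejects. -/
def rejectionProb {𝒳 E : Type*} [MeasurableSpace 𝒳] [MeasurableSpace E] {L W : ℕ} [NeZero W]
    (PΩ : Measure E) (T : ∀ n, (Fin n → 𝒳) × E → Fin L → ℝ) (F₀ : ℝ → ℝ)
    (S : Fin W → (Fin L → ℝ) → ℝ) (J : ℕ) (α : ℝ) (n m : ℕ) (P : ProbabilityMeasure 𝒳) : ℝ :=
  (inputLaw P PΩ J n m).real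
    {I | AdaptiveRejects F₀ S α (T n I.1) (subsampleMatrix (T m) I)}

end

end RankSub

/-! The test behaves like an oracle test. Write `R = max_w G^w(S_n^w)` with the limiting `G^w`, and
let `Q` be the limit law of `R`. The oracle rejects when `Q(R)` exceeds `1 - α`, and `Q(R)` is
asymptotically uniform as soon as `Q` is continuous.

Three facts give this comparison. Given the permutations, the blocks of one permutation are
independent copies of the input of `T_m`, so Chebyshev's inequality with `n/m → ∞` concentrates
every subsampling frequency; different permutations may overlap, but a union bound over the fixed
number `J` suffices (`measure_freq_deviation_le`). On a finite grid this yields uniform convergence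
of the empirical distribution functions of the entries, of each `S^w` and of the maximum to `F₀`,
`G^w` and `Q`.

Next, `F₀⁻¹` composed with a uniform approximation of `F₀` is close to the identity on a compact
interval. All but a few rows have their entries there, and the `S^w` are Lipschitz, so the rank
transform hardly changes the aggregated statistics. `adaptiveRejects_sandwich` turns this into a
deterministic comparison with the oracle.

Finally, `Q` needs no assumed density: each `G^w(S_n^w)` is asymptotically uniform, so a maximum in
`(x, y]` has limiting probability at most `W (y - x)` (`isRegularFamily_maxStat`).

The subsampling limits are deterministic, so the dependence between the full sample and its
subsamples plays no role. All bounds are uniform over the null set; the pointwise claim is the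
uniform one for a single law. -/

namespace RankSub

/-! ### Independence of the subsamples -/

section Independence

/-- Reindexing by an injective map pushes a power measure to a power measure. -/
theorem map_comp_pi_of_injective {ι κ X : Type*} [Fintype ι] [Fintype κ] [MeasurableSpace X]
    (P : Measure X) [IsProbabilityMeasure P] {φ : κ → ι} (hφ : Function.Injective φ) :
    (Measure.pi fun _ : ι => P).map (fun x k => x (φ k)) = Measure.pi fun _ : κ => P := by
  classical
  refine (Measure.pi_eq fun s hs => ?_).symm
  rw [Measure.map_apply (by fun_prop) (MeasurableSet.univ_pi hs)]
  -- The preimage is again a box: the side at `φ k` is `s k` by injectivity, and a side outside the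
  -- range of `φ` is the whole space, of mass one.
  have : (fun (x : ι → X) k => x (φ k)) ⁻¹' Set.univ.pi s
      = Set.univ.pi fun i => ⋂ k, {z | φ k = i → z ∈ s k} := by
    ext x
    simp only [Set.mem_preimage, Set.mem_univ_pi, Set.mem_iInter, Set.mem_ofPred_eq]
    exact ⟨fun h i k hk => hk ▸ h k, fun h k => h _ k rfl⟩
  rw [this, Measure.pi_pi]
  have h1 : ∀ k, P (⋂ k', {z | φ k' = φ k → z ∈ s k'}) = P (s k) := by
    intro k
    congr 1
    ext z
    simp only [Set.mem_iInter, Set.mem_ofPred_eq]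
    exact ⟨fun h => h k rfl, fun h k' hk' => hφ hk' ▸ h⟩
  rw [← Finset.prod_subset (Finset.subset_univ (Finset.univ.image φ)),
    Finset.prod_image fun a _ b _ h => hφ h]
  · exact Finset.prod_congr rfl fun k _ => h1 k
  · intro i _ hi
    have : ⋂ k, {z | φ k = i → z ∈ s k} = Set.univ := by
      ext z
      simp only [Set.mem_iInter, Set.mem_ofPred_eq, Set.mem_univ, iff_true]
      intro k hk
      exact absurd (Finset.mem_image.2 ⟨k, Finset.mem_univ _, hk⟩) hi
    rw [this, measure_univ]

/-- Disjoint subfamilies of iid coordinates are independent. -/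
theorem indepFun_comp_pi {ι κ κ' X : Type*} [Fintype ι] [Fintype κ] [Fintype κ']
    [MeasurableSpace X] (P : Measure X) [IsProbabilityMeasure P] (φ : κ → ι) (ψ : κ' → ι)
    (h : ∀ k k', φ k ≠ ψ k') :
    IndepFun (fun (x : ι → X) k => x (φ k)) (fun x k => x (ψ k)) (Measure.pi fun _ => P) := by
  classical
  have hi : iIndepFun (fun i (x : ι → X) => x i) (Measure.pi fun _ => P) :=
    iIndepFun_pi (X := fun _ => id) fun _ => aemeasurable_id
  have := hi.indepFun_finset (Finset.univ.image φ) (Finset.univ.image ψ) (by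
    rw [Finset.disjoint_left]
    intro i hi hi'
    obtain ⟨k, -, rfl⟩ := Finset.mem_image.1 hi
    obtain ⟨k', -, hk'⟩ := Finset.mem_image.1 hi'
    exact h k k' hk'.symm) (fun i => measurable_pi_apply i)
  exact this.comp
    (φ := fun z k => z ⟨φ k, Finset.mem_image_of_mem _ (Finset.mem_univ _)⟩)
    (ψ := fun z k => z ⟨ψ k, Finset.mem_image_of_mem _ (Finset.mem_univ _)⟩)
    (by fun_prop) (by fun_prop)

theorem measurable_reindex {ι κ X : Type*} [MeasurableSpace X] (φ : κ → ι) :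
    Measurable fun (x : ι → X) k => x (φ k) :=
  measurable_pi_lambda _ fun _ => measurable_pi_apply _

theorem map_prod_prod_comm {α β γ δ : Type*} [MeasurableSpace α] [MeasurableSpace β]
    [MeasurableSpace γ] [MeasurableSpace δ] (μa : Measure α) (μb : Measure β) (μc : Measure γ)
    (μd : Measure δ) [SFinite μa] [SFinite μb] [SFinite μc] [SFinite μd] :
    ((μa.prod μc).prod (μb.prod μd)).map (fun p => ((p.1.1, p.2.1), (p.1.2, p.2.2)))
      = (μa.prod μb).prod (μc.prod μd) := by
  have h1 := measurePreserving_prodAssoc μa μc (μb.prod μd)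
  have h2 := (MeasurePreserving.id μa).prod
    (MeasurePreserving.symm _ (measurePreserving_prodAssoc μc μb μd))
  have h3 := (MeasurePreserving.id μa).prod
    ((Measure.measurePreserving_swap (μ := μc) (ν := μb)).prod (MeasurePreserving.id μd))
  have h4 := (MeasurePreserving.id μa).prod (measurePreserving_prodAssoc μb μc μd)
  have h5 := MeasurePreserving.symm _ (measurePreserving_prodAssoc μa μb (μc.prod μd))
  exact (h5.comp (h4.comp (h3.comp (h2.comp h1)))).map_eq

/-- Conditioning on the second coordinate: a conditional law that does not depend on it is also the
unconditional law. It is applied with the permutations as second coordinate. -/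
theorem map_prod_of_forall {α β γ : Type*} [MeasurableSpace α] [MeasurableSpace β]
    [MeasurableSpace γ] (μ : Measure α) (τ : Measure β) [SFinite μ] [IsProbabilityMeasure τ]
    (ν : Measure γ) {f : α × β → γ} (hf : Measurable f)
    (h : ∀ b, μ.map (fun a => f (a, b)) = ν) : (μ.prod τ).map f = ν := by
  ext s hs
  rw [Measure.map_apply hf hs, Measure.prod_apply_symm (hf hs)]
  have : ∀ b, μ ((fun a => (a, b)) ⁻¹' (f ⁻¹' s)) = ν s := by
    intro b
    rw [← h b, Measure.map_apply (by fun_prop) hs]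
    rfl
  simp [this]

variable {𝒳 E : Type*} [MeasurableSpace 𝒳] [MeasurableSpace E]

/-- The data and the external randomness entering the subsample `b`. -/
def subsampleInput {J n m : ℕ} (b : Rows J n m) (I : Inputs 𝒳 E J n m) : (Fin m → 𝒳) × E :=
  (fun i => I.1.1 (blockIndex (I.2.2 b.1) b.2 i), I.2.1 b)

theorem blockIndex_injective {n m : ℕ} (π : Equiv.Perm (Fin n)) {k k' : Fin (n / m)}
    {i i' : Fin m} (h : blockIndex π k i = blockIndex π k' i') : k = k' ∧ i = i' := by
  have h1 := congrArg Fin.val (π.injective h)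
  simp only at h1
  have hi := i.isLt
  have hi' := i'.isLt
  have hk : (k : ℕ) = k' := by
    have e1 : ((k : ℕ) * m + i) / m = k := by
      rw [mul_comm, Nat.mul_add_div (by omega), Nat.div_eq_of_lt hi, add_zero]
    have e2 : ((k' : ℕ) * m + i') / m = k' := by
      rw [mul_comm, Nat.mul_add_div (by omega), Nat.div_eq_of_lt hi', add_zero]
    rw [← e1, ← e2, h1]
  rw [hk] at h1
  exact ⟨Fin.ext hk, Fin.ext (by omega)⟩

instance (n : ℕ) : MeasurableSingletonClass (Equiv.Perm (Fin n)) :=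
  ⟨fun _ => MeasurableSpace.measurableSet_top⟩

theorem measurable_subsampleInput {J n m : ℕ} (b : Rows J n m) :
    Measurable (subsampleInput (𝒳 := 𝒳) (E := E) b) := by
  have h : Measurable fun q : ((Fin n → 𝒳) × E) × (Rows J n m → E) × (Fin J → Equiv.Perm (Fin n)) =>
      (q.1.1, q.2.2) := by fun_prop
  refine Measurable.prodMk ?_ (by fun_prop)
  have h' : Measurable fun q : (Fin n → 𝒳) × (Fin J → Equiv.Perm (Fin n)) =>
      fun i : Fin m => q.1 (blockIndex (q.2 b.1) b.2 i) :=
    measurable_from_prod_countable_left fun π => measurable_reindex (fun i => blockIndex (π b.1) b.2 i)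
  exact h'.comp h

variable (P : ProbabilityMeasure 𝒳) (PΩ : Measure E) [IsProbabilityMeasure PΩ]

instance (J n m : ℕ) : IsProbabilityMeasure (inputLaw P PΩ J n m) := by
  unfold inputLaw; infer_instance

theorem map_inputLaw_of_forall {J n m : ℕ} {γ : Type*} [MeasurableSpace γ] (ν : Measure γ)
    {f : Inputs 𝒳 E J n m → γ} (hf : Measurable f)
    (h : ∀ π, ((dataLaw P PΩ n).prod (Measure.pi fun _ : Rows J n m => PΩ)).map
      (fun a => f (a.1, a.2, π)) = ν) : (inputLaw P PΩ J n m).map f = ν := by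
  rw [inputLaw, ← Measure.prodAssoc_prod, Measure.map_map hf (MeasurableEquiv.measurable _)]
  exact map_prod_of_forall _ _ _ (hf.comp (MeasurableEquiv.measurable _)) h

/-- For fixed permutations, two blocks of the same permutation read disjoint coordinates of the data
and different copies of the external randomness. The resulting product law is free of the
permutations. Blocks of different permutations can share data, hence the common `j`. -/
theorem map_subsampleInput_pair {J n m : ℕ} (j : Fin J) {k k' : Fin (n / m)} (hk : k ≠ k') :
    (inputLaw P PΩ J n m).map (fun I => (subsampleInput (j, k) I, subsampleInput (j, k') I))
      = (dataLaw P PΩ m).prod (dataLaw P PΩ m) := by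
  refine map_inputLaw_of_forall P PΩ _
    ((measurable_subsampleInput _).prodMk (measurable_subsampleInput _)) fun π => ?_
  have hX := (indepFun_comp_pi (P : Measure 𝒳) (blockIndex (π j) k) (blockIndex (π j) k')
    fun i i' h => hk (blockIndex_injective _ h).1).map_prod_eq_prod_map_map
      (measurable_reindex _).aemeasurable (measurable_reindex _).aemeasurable
  rw [map_comp_pi_of_injective (P : Measure 𝒳) fun i i' h => (blockIndex_injective _ h).2,
    map_comp_pi_of_injective (P : Measure 𝒳) fun i i' h => (blockIndex_injective _ h).2] at hX
  have hE := (iIndepFun_pi (μ := fun _ : Rows J n m => PΩ) (X := fun _ => id)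
    fun _ => aemeasurable_id).indepFun (i := (j, k)) (j := (j, k')) (by simpa using hk)
  simp only [id] at hE
  have hE := hE.map_prod_eq_prod_map_map (measurable_pi_apply _).aemeasurable
    (measurable_pi_apply _).aemeasurable
  rw [(measurePreserving_eval (fun _ : Rows J n m => PΩ) (j, k)).map_eq,
    (measurePreserving_eval (fun _ : Rows J n m => PΩ) (j, k')).map_eq] at hE
  have h1 : (dataLaw P PΩ n).map Prod.fst = Measure.pi fun _ : Fin n => (P : Measure 𝒳) := by
    simp [dataLaw, Measure.map_fst_prod]
  have h2 : ((dataLaw P PΩ n).prod (Measure.pi fun _ : Rows J n m => PΩ)).map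
      (fun a => (a.1.1, a.2)) = (Measure.pi fun _ : Fin n => (P : Measure 𝒳)).prod
        (Measure.pi fun _ : Rows J n m => PΩ) := by
    rw [← h1]
    conv_rhs => rw [← Measure.map_id (μ := Measure.pi fun _ : Rows J n m => PΩ)]
    rw [Measure.map_prod_map _ _ (by fun_prop) (by fun_prop)]
    rfl
  have h3 := Measure.map_prod_map (Measure.pi fun _ : Fin n => (P : Measure 𝒳))
    (Measure.pi fun _ : Rows J n m => PΩ)
    (f := fun x => (fun i => x (blockIndex (π j) k i), fun i => x (blockIndex (π j) k' i)))
    (g := fun ω => (ω (j, k), ω (j, k'))) (by fun_prop) (by fun_prop)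
  rw [hX, hE, ← h2, Measure.map_map (by fun_prop) (by fun_prop)] at h3
  have h4 := map_prod_prod_comm (Measure.pi fun _ : Fin m => (P : Measure 𝒳)) PΩ
    (Measure.pi fun _ : Fin m => (P : Measure 𝒳)) PΩ
  rw [h3, Measure.map_map (by fun_prop) (by fun_prop)] at h4
  exact h4

theorem map_subsampleInput {J n m : ℕ} (b : Rows J n m) :
    (inputLaw P PΩ J n m).map (subsampleInput b) = dataLaw P PΩ m := by
  refine map_inputLaw_of_forall P PΩ _ (measurable_subsampleInput _) fun π => ?_
  have h1 : (dataLaw P PΩ n).map Prod.fst = Measure.pi fun _ : Fin n => (P : Measure 𝒳) := by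
    simp [dataLaw, Measure.map_fst_prod]
  have h2 : (dataLaw P PΩ n).map (fun a i => a.1 (blockIndex (π b.1) b.2 i))
      = Measure.pi fun _ : Fin m => (P : Measure 𝒳) := by
    rw [← map_comp_pi_of_injective (P : Measure 𝒳)
      (φ := blockIndex (π b.1) b.2) fun i i' h => (blockIndex_injective _ h).2, ← h1,
      Measure.map_map (by fun_prop) (by fun_prop)]
    rfl
  have h3 := Measure.map_prod_map (dataLaw P PΩ n) (Measure.pi fun _ : Rows J n m => PΩ)
    (f := fun a i => a.1 (blockIndex (π b.1) b.2 i)) (g := Function.eval b)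
    (by fun_prop) (by fun_prop)
  rw [h2, (measurePreserving_eval (fun _ : Rows J n m => PΩ) b).map_eq] at h3
  exact h3.symm

theorem indepFun_subsampleInput {J n m : ℕ} (j : Fin J) {k k' : Fin (n / m)} (hk : k ≠ k') :
    IndepFun (subsampleInput (j, k)) (subsampleInput (j, k')) (inputLaw P PΩ J n m) := by
  rw [indepFun_iff_map_prod_eq_prod_map_map (measurable_subsampleInput _).aemeasurable
    (measurable_subsampleInput _).aemeasurable, map_subsampleInput, map_subsampleInput,
    map_subsampleInput_pair P PΩ j hk]

end Independence

/-! ### Concentration of subsampling frequencies -/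

section Concentration

/-- The proportion of indices satisfying `p`. -/
noncomputable def freq {ι : Type*} [Fintype ι] (p : ι → Prop) [DecidablePred p] : ℝ :=
  ((Finset.univ.filter p).card : ℝ) / (Fintype.card ι : ℝ)

variable {𝒳 E : Type*} [MeasurableSpace 𝒳] [MeasurableSpace E]
variable (P : ProbabilityMeasure 𝒳) (PΩ : Measure E) [IsProbabilityMeasure PΩ]

open Classical in
/-- Along the blocks of one permutation, the frequency of an event is concentrated. -/
theorem measure_block_deviation_le {J n m : ℕ} (hK : 0 < n / m) (j : Fin J)
    {A : Set ((Fin m → 𝒳) × E)} (hA : MeasurableSet A) {ε : ℝ} (hε : 0 < ε) :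
    (inputLaw P PΩ J n m).real {I | ε * (n / m : ℕ) ≤
      |∑ k : Fin (n / m), (A.indicator 1 (subsampleInput (j, k) I) : ℝ)
        - (n / m : ℕ) * (dataLaw P PΩ m).real A|} ≤ 1 / (ε ^ 2 * (n / m : ℕ)) := by
  set K := n / m
  have hK' : (0 : ℝ) < K := by exact_mod_cast hK
  have hεK : 0 < ε ^ 2 * (K : ℝ) := by positivity
  set μ := inputLaw P PΩ J n m
  let Z : Fin K → Inputs 𝒳 E J n m → ℝ := fun k I => A.indicator 1 (subsampleInput (j, k) I)
  have hind : Measurable (A.indicator (1 : (Fin m → 𝒳) × E → ℝ)) := measurable_one.indicator hA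
  have hZ : ∀ k, Measurable (Z k) := fun k => hind.comp (measurable_subsampleInput _)
  have hZb : ∀ k I, Z k I ∈ Set.Icc (0 : ℝ) 1 := by
    intro k I
    by_cases h : subsampleInput (j, k) I ∈ A <;> simp [Z, h]
  have hL : ∀ k, MemLp (Z k) 2 μ := fun k =>
    MemLp.of_bound (hZ k).aestronglyMeasurable 1 (ae_of_all _ fun I => by
      rw [Real.norm_eq_abs, abs_of_nonneg (hZb k I).1]; exact (hZb k I).2)
  have hLs : MemLp (∑ k, Z k) 2 μ := memLp_finsetSum' _ fun k _ => hL k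
  have hmean : ∀ k, μ[Z k] = (dataLaw P PΩ m).real A := by
    intro k
    have := integral_map (μ := μ) (measurable_subsampleInput (j, k)).aemeasurable
      (f := A.indicator (1 : (Fin m → 𝒳) × E → ℝ)) hind.aestronglyMeasurable
    rw [map_subsampleInput, integral_indicator_one hA] at this
    exact this.symm
  have hsum : μ[∑ k, Z k] = K * (dataLaw P PΩ m).real A := by
    simp only [Finset.sum_apply]
    rw [integral_finsetSum _ fun k _ => (hL k).integrable (by norm_num)]
    simp [hmean]
  -- Pairwise independence makes variances add up, and an indicator has variance at most `1/4`; the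
  -- cruder bound `1` is enough for Chebyshev.
  have hvar : Var[∑ k, Z k; μ] ≤ K := by
    rw [IndepFun.variance_sum (fun k _ => hL k) fun k _ k' _ hk =>
      (indepFun_subsampleInput P PΩ j hk).comp hind hind]
    calc ∑ k, Var[Z k; μ] ≤ ∑ _k : Fin K, (1 : ℝ) := Finset.sum_le_sum fun k _ =>
          (variance_le_sq_of_bounded (ae_of_all _ (hZb k)) (hZ k).aemeasurable).trans (by norm_num)
      _ = K := by simp
  have h := meas_ge_le_variance_div_sq hLs (c := ε * K) (by positivity)
  rw [hsum] at h
  simp only [Finset.sum_apply] at h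
  refine (ENNReal.toReal_le_of_le_ofReal (div_nonneg (variance_nonneg _ _) (sq_nonneg _)) h).trans ?_
  calc Var[∑ k, Z k; μ] / (ε * K) ^ 2 ≤ K / (ε * K) ^ 2 := by gcongr
    _ = 1 / (ε ^ 2 * K) := by field_simp

-- The overall frequency is the average of the `J` frequencies along single permutations, so a
-- deviation of the average forces one in some permutation. The union bound costs a factor `J` and
-- needs no independence between permutations.
open Classical in
theorem measure_freq_deviation_le {J n m : ℕ} (hJ : 1 ≤ J) (hK : 0 < n / m)
    {A : Set ((Fin m → 𝒳) × E)} (hA : MeasurableSet A) {ε : ℝ} (hε : 0 < ε) :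
    (inputLaw P PΩ J n m).real {I | ε ≤
      |freq (fun b : Rows J n m => subsampleInput b I ∈ A) - (dataLaw P PΩ m).real A|}
        ≤ J / (ε ^ 2 * (n / m : ℕ)) := by
  set K := n / m
  have hK' : (0 : ℝ) < K := by exact_mod_cast hK
  have hJ' : (0 : ℝ) < J := by exact_mod_cast hJ
  have hsub : {I | ε ≤ |freq (fun b : Rows J n m => subsampleInput b I ∈ A)
      - (dataLaw P PΩ m).real A|} ⊆ ⋃ j : Fin J, {I | ε * K ≤
      |∑ k : Fin K, (A.indicator 1 (subsampleInput (j, k) I) : ℝ)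
        - K * (dataLaw P PΩ m).real A|} := by
    intro I hI
    by_contra hcon
    simp only [Set.mem_iUnion, Set.mem_ofPred_eq, not_exists, not_le] at hcon hI
    have hf : freq (fun b : Rows J n m => subsampleInput b I ∈ A)
        - (dataLaw P PΩ m).real A = (∑ j : Fin J, (∑ k : Fin K,
          (A.indicator 1 (subsampleInput (j, k) I) : ℝ) - K * (dataLaw P PΩ m).real A))
          / (J * K) := by
      rw [freq, Finset.card_filter, Finset.sum_sub_distrib, Fintype.card_prod, Fintype.card_fin,
        Fintype.card_fin, Nat.cast_sum, Fintype.sum_prod_type]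
      simp only [Set.indicator_apply, Pi.one_apply, Nat.cast_ite, Nat.cast_one, Nat.cast_zero,
        Finset.sum_const, Finset.card_univ, Fintype.card_fin, nsmul_eq_mul, Nat.cast_mul]
      rw [show ((n / m : ℕ) : ℝ) = K from rfl]
      field_simp
      congr!
    rw [hf, abs_div, abs_of_pos (by positivity : (0 : ℝ) < J * K), le_div_iff₀ (by positivity)] at hI
    have := Finset.abs_sum_le_sum_abs (fun j : Fin J => ∑ k : Fin K,
      (A.indicator 1 (subsampleInput (j, k) I) : ℝ) - K * (dataLaw P PΩ m).real A) Finset.univ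
    have h2 : ∑ j : Fin J, |∑ k : Fin K, (A.indicator 1 (subsampleInput (j, k) I) : ℝ)
        - K * (dataLaw P PΩ m).real A| < ∑ _j : Fin J, ε * K :=
      Finset.sum_lt_sum_of_nonempty ⟨⟨0, hJ⟩, Finset.mem_univ _⟩ fun j _ => hcon j
    simp only [Finset.sum_const, Finset.card_univ, Fintype.card_fin, nsmul_eq_mul] at h2
    linarith
  refine (measureReal_mono hsub).trans ((measureReal_iUnion_fintype_le _).trans ?_)
  calc _ ≤ ∑ _j : Fin J, 1 / (ε ^ 2 * (K : ℝ)) :=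
        Finset.sum_le_sum fun j _ => measure_block_deviation_le P PΩ hK j hA hε
    _ = J / (ε ^ 2 * K) := by
        simp only [Finset.sum_const, Finset.card_univ, Fintype.card_fin, nsmul_eq_mul]
        ring

end Concentration

/-! ### Deterministic comparison of empirical distribution functions -/

section Deterministic

section Frequencies

variable {ι : Type*} [Fintype ι]

theorem freq_nonneg (p : ι → Prop) [DecidablePred p] : 0 ≤ freq p := by
  unfold freq; positivity

theorem freq_le_one (p : ι → Prop) [DecidablePred p] : freq p ≤ 1 :=
  div_le_one_of_le₀ (by exact_mod_cast Finset.card_le_univ _) (by positivity)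

theorem freq_mono {p q : ι → Prop} [DecidablePred p] [DecidablePred q] (h : ∀ i, p i → q i) :
    freq p ≤ freq q := by
  unfold freq
  gcongr with i
  exact h i

theorem freq_le_add {p q r : ι → Prop} [DecidablePred p] [DecidablePred q] [DecidablePred r]
    (h : ∀ i, p i → q i ∨ r i) : freq p ≤ freq q + freq r := by
  classical
  unfold freq
  rw [← add_div]
  gcongr
  rw [← Nat.cast_add]
  norm_cast
  refine (Finset.card_le_card ?_).trans (Finset.card_union_le _ _)
  intro i
  simpa using h i

theorem ecdf_mem_Icc (x : ι → ℝ) (t : ℝ) : ecdf x t ∈ Set.Icc (0 : ℝ) 1 :=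
  ⟨freq_nonneg _, freq_le_one _⟩

theorem monotone_ecdf (x : ι → ℝ) : Monotone (ecdf x) :=
  fun _ _ h => freq_mono fun _ hi => hi.trans h

/-- If two families of points are close up to a small proportion of the indices and one empirical
distribution function is close to a Lipschitz function, so is the other. -/
theorem abs_ecdf_sub_le_of_close {u v : ι → ℝ} {bad : ι → Prop} [DecidablePred bad] {G : ℝ → ℝ}
    {ε η η' C : ℝ} (huv : ∀ b, ¬ bad b → |u b - v b| ≤ ε) (hbad : freq bad ≤ η)
    (hε : 0 ≤ ε) (hv : ∀ x, |ecdf v x - G x| ≤ η') (hG : ∀ x y, |G x - G y| ≤ C * |x - y|) (x : ℝ) :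
    |ecdf u x - G x| ≤ η + η' + C * ε := by
  -- Off the bad indices, `u b ≤ x` forces `v b ≤ x + ε`, and symmetrically; the Lipschitz bound on
  -- `G` then undoes the shift.
  have h1 : ecdf u x ≤ ecdf v (x + ε) + freq bad := freq_le_add fun b hb => by
    by_cases h : bad b
    · exact Or.inr h
    · have := abs_le.1 (huv b h)
      exact Or.inl (by linarith)
  have h2 : ecdf v (x - ε) ≤ ecdf u x + freq bad := freq_le_add fun b hb => by
    by_cases h : bad b
    · exact Or.inr h
    · have := abs_le.1 (huv b h)
      exact Or.inl (by linarith)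
  have h3 := abs_le.1 (hv (x + ε))
  have h4 := abs_le.1 (hv (x - ε))
  have h5 := hG (x + ε) x
  have h6 := hG (x - ε) x
  rw [add_sub_cancel_left, abs_of_nonneg hε] at h5
  rw [sub_sub_cancel_left, abs_neg, abs_of_nonneg hε] at h6
  have h5 := abs_le.1 h5
  have h6 := abs_le.1 h6
  rw [abs_le]
  constructor <;> linarith

end Frequencies

/-- Uniform closeness of a distribution function to a Lipschitz one that is concentrated
on `[-M, M]` can be checked on a finite grid. -/
theorem exists_grid (K M : ℝ) {ε : ℝ} (hε : 0 < ε) :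
    ∃ s : Finset ℝ, ∀ F G : ℝ → ℝ, Monotone F → (∀ x, F x ∈ Set.Icc (0 : ℝ) 1) →
      Monotone G → (∀ x, G x ∈ Set.Icc (0 : ℝ) 1) → (∀ x y, |G x - G y| ≤ K * |x - y|) →
      G (-M) ≤ ε → 1 - ε ≤ G M → (∀ x ∈ s, |F x - G x| ≤ ε) → ∀ x, |F x - G x| ≤ 2 * ε := by
  -- The mesh is such that `G` gains at most `ε` per cell; with the error `ε` at the nodes,
  -- monotonicity gives `2ε` in between. Beyond the ends both functions are within `2ε` of `0` or
  -- `1`.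
  obtain ⟨h, hh, hKh⟩ : ∃ h : ℝ, 0 < h ∧ K * h ≤ ε := by
    refine ⟨ε / (|K| + 1), by positivity, ?_⟩
    rw [mul_div_assoc', div_le_iff₀ (by positivity)]
    nlinarith [le_abs_self K]
  obtain ⟨N, hN⟩ := exists_nat_ge (2 * M / h)
  rw [div_le_iff₀ hh] at hN
  refine ⟨(Finset.range (N + 1)).image fun i : ℕ => -M + i * h, ?_⟩
  intro F G hF hF01 hG hG01 hK hlo hhi hs x
  have hgrid : ∀ i : ℕ, i ≤ N → |F (-M + i * h) - G (-M + i * h)| ≤ ε := fun i hi =>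
    hs _ (Finset.mem_image_of_mem _ (Finset.mem_range.2 (by omega)))
  rcases lt_or_ge x (-M) with hx | hx
  · have h0 := abs_le.1 (hgrid 0 (Nat.zero_le _))
    simp only [Nat.cast_zero, zero_mul, add_zero] at h0
    have h1 := hF hx.le
    have h2 := hG hx.le
    have h3 := (hF01 x).1
    have h4 := (hG01 x).1
    rw [abs_le]; constructor <;> linarith
  rcases le_or_gt (-M + N * h) x with hx' | hx'
  · have h0 := abs_le.1 (hgrid N le_rfl)
    have h1 := hF hx'
    have h2 := hG hx'
    have h3 := (hF01 x).2
    have h4 := (hG01 x).2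
    have h5 : G M ≤ G (-M + N * h) := hG (by linarith)
    rw [abs_le]; constructor <;> linarith
  · set i := ⌊(x + M) / h⌋₊ with hi
    have hi1 : (i : ℝ) * h ≤ x + M := by
      rw [← le_div_iff₀ hh]
      exact Nat.floor_le (div_nonneg (by linarith) hh.le)
    have hi2 : x + M < (i + 1) * h := by
      rw [← div_lt_iff₀ hh]
      exact Nat.lt_floor_add_one _
    have hiN : i + 1 ≤ N := by
      have : (i : ℝ) < N := lt_of_mul_lt_mul_right (by linarith) hh.le
      exact_mod_cast this
    have h0 := abs_le.1 (hgrid i (by omega))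
    have h1 := abs_le.1 (hgrid (i + 1) hiN)
    push_cast at h1
    have h2 : F (-M + i * h) ≤ F x := hF (by linarith)
    have h3 : F x ≤ F (-M + (i + 1) * h) := hF (by linarith)
    have h4 : G (-M + i * h) ≤ G x := hG (by linarith)
    have h5 : G x ≤ G (-M + (i + 1) * h) := hG (by linarith)
    have h6 := hK (-M + (i + 1) * h) (-M + i * h)
    rw [show -M + (i + 1) * h - (-M + i * h) = h by ring, abs_of_pos hh] at h6
    have h6 := abs_le.1 h6
    rw [abs_le]; constructor <;> linarith

/-! ### Quantiles -/

theorem quantile_mem_Icc {F : ℝ → ℝ} (hF : Monotone F) {p y z : ℝ} (hy : F y < p) (hz : p ≤ F z) :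
    quantile F p ∈ Set.Icc y z := by
  have hlb : y ∈ lowerBounds {x | p ≤ F x} := fun x hx =>
    le_of_lt (hF.reflect_lt (lt_of_lt_of_le hy hx))
  exact ⟨le_csInf ⟨z, hz⟩ hlb, csInf_le ⟨y, hlb⟩ hz⟩

/-- Uniform continuity of the quantile transform on a compact set inside the support. -/
theorem exists_quantile_close {F : ℝ → ℝ} (hF : Monotone F) (hc : Continuous F)
    (hs : ∀ x y, x < y → F x < 1 → 0 < F y → F x < F y) {a b : ℝ} (ha : 0 < F a) (hb : F b < 1)
    {ε : ℝ} (hε : 0 < ε) :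
    ∃ δ > 0, ∀ x ∈ Set.Icc a b, ∀ p, |p - F x| ≤ δ → |quantile F p - x| ≤ ε := by
  rcases (Set.Icc a b).eq_empty_or_nonempty with he | hne
  · exact ⟨1, one_pos, by simp [he]⟩
  -- `g` is the smaller increment of `F` over a step `ε` to either side. It has a positive minimum
  -- on the compact interval, and half of it leaves the strict inequality `F (x - ε) < p` needed to
  -- bracket the quantile.
  let g : ℝ → ℝ := fun x => min (F x - F (x - ε)) (F (x + ε) - F x)
  have hg : Continuous g := by fun_prop
  obtain ⟨x₀, hx₀, hmin⟩ := isCompact_Icc.exists_isMinOn hne hg.continuousOn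
  have hpos : 0 < g x₀ := by
    have h0 : 0 < F x₀ := ha.trans_le (hF hx₀.1)
    have h1 : F x₀ < 1 := (hF hx₀.2).trans_lt hb
    have h2 : F (x₀ - ε) < F x₀ :=
      hs _ _ (by linarith) ((hF (by linarith)).trans_lt h1) h0
    have h3 : F x₀ < F (x₀ + ε) :=
      hs _ _ (by linarith) h1 (h0.trans_le (hF (by linarith)))
    exact lt_min (by linarith) (by linarith)
  refine ⟨g x₀ / 2, by linarith, fun x hx p hp => ?_⟩
  have hgx : g x₀ ≤ g x := hmin hx
  have h1 : g x ≤ F x - F (x - ε) := min_le_left _ _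
  have h2 : g x ≤ F (x + ε) - F x := min_le_right _ _
  have hp := abs_le.1 hp
  have := quantile_mem_Icc hF (p := p) (y := x - ε) (z := x + ε) (by linarith) (by linarith)
  rw [abs_le]
  constructor <;> linarith [this.1, this.2]

variable {ι : Type*} [Fintype ι]

theorem ecdf_eq_one [Nonempty ι] {x : ι → ℝ} {t : ℝ} (h : ∀ i, x i ≤ t) : ecdf x t = 1 := by
  unfold ecdf
  rw [Finset.filter_true_of_mem fun i _ => h i, Finset.card_univ]
  exact div_self (by exact_mod_cast Fintype.card_ne_zero)

theorem ecdf_eq_zero {x : ι → ℝ} {t : ℝ} (h : ∀ i, t < x i) : ecdf x t = 0 := by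
  unfold ecdf
  rw [Finset.filter_false_of_mem fun i _ => not_le.2 (h i)]
  simp

/-- `p ≤ 1` makes the set in the quantile nonempty, so that `sInf` is not its default value `0`. -/
theorem le_ecdf_of_quantile_lt [Nonempty ι] {x : ι → ℝ} {p r : ℝ} (hp : p ≤ 1)
    (h : quantile (ecdf x) p < r) : p ≤ ecdf x r := by
  obtain ⟨M, hM⟩ := (Set.finite_range x).bddAbove
  have hne : {t | p ≤ ecdf x t}.Nonempty :=
    ⟨M, by simpa [ecdf_eq_one fun i => hM ⟨i, rfl⟩] using hp⟩
  obtain ⟨y, hy, hyr⟩ := exists_lt_of_csInf_lt hne h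
  exact le_trans hy (monotone_ecdf x hyr.le)

/-- `0 < p` bounds the set in the quantile from below. The conclusion stops strictly short of `r`:
if `r` equals the quantile, the empirical distribution function may already have jumped to `p`
there. -/
theorem ecdf_lt_of_le_quantile {x : ι → ℝ} {p r y : ℝ} (hp : 0 < p)
    (h : r ≤ quantile (ecdf x) p) (hy : y < r) : ecdf x y < p := by
  by_contra! hcon
  obtain ⟨M, hM⟩ := (Set.finite_range x).bddBelow
  have hbdd : BddBelow {t | p ≤ ecdf x t} := by
    refine ⟨M, fun t ht => ?_⟩
    by_contra! htM
    have : ecdf x t = 0 := ecdf_eq_zero fun i => htM.trans_le (hM ⟨i, rfl⟩)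
    rw [Set.mem_ofPred_eq, this] at ht
    linarith
  exact absurd (csInf_le hbdd hcon) (not_le.2 (hy.trans_le h))

/-! ### The adaptive test on a good realisation -/

variable {L W : ℕ} [NeZero W]

theorem abs_maxStat_sub_le {G G' : Fin W → ℝ → ℝ} {S : Fin W → (Fin L → ℝ) → ℝ} {s t : Fin L → ℝ}
    {r : ℝ} (h : ∀ w, |G w (S w s) - G' w (S w t)| ≤ r) :
    |maxStat G S s - maxStat G' S t| ≤ r := by
  have key : ∀ (G G' : Fin W → ℝ → ℝ) (s t : Fin L → ℝ),
      (∀ w, |G w (S w s) - G' w (S w t)| ≤ r) → maxStat G S s - maxStat G' S t ≤ r := by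
    intro G G' s t h
    rw [sub_le_iff_le_add]
    refine Finset.sup'_le _ _ fun w _ => ?_
    have h1 : G' w (S w t) ≤ maxStat G' S t :=
      Finset.le_sup' (fun w => G' w (S w t)) (Finset.mem_univ w)
    linarith [(abs_le.1 (h w)).2]
  rw [abs_sub_le_iff]
  exact ⟨key _ _ _ _ h, key _ _ _ _ fun w => abs_sub_comm (G w (S w s)) _ ▸ h w⟩

/-- The continuity correction `1 / (2BL)` is treated as one more part of the tolerance `δ`. -/
theorem abs_rankTransform_sub_le {F₀ : ℝ → ℝ} {H : ι → Fin L → ℝ} {a b ε δ : ℝ}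
    (hq : ∀ x ∈ Set.Icc a b, ∀ p, |p - F₀ x| ≤ δ → |quantile F₀ p - x| ≤ ε)
    (hF : ∀ x, |ecdf (fun p : ι × Fin L => H p.1 p.2) x - F₀ x|
      + 1 / (2 * (Fintype.card ι : ℝ) * (L : ℝ)) ≤ δ)
    {i : ι} {l : Fin L} (hi : H i l ∈ Set.Icc a b) :
    |rankTransform F₀ H i l - H i l| ≤ ε := by
  refine hq _ hi _ ?_
  have h := hF (H i l)
  have h0 : 0 ≤ 1 / (2 * (Fintype.card ι : ℝ) * (L : ℝ)) := by positivity
  have h1 := abs_le.1 (le_sub_iff_add_le.2 h)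
  rw [abs_le]
  constructor <;> linarith

open Classical in
/-- If the empirical distribution functions of the entries, of the aggregated statistics and of
their maximum are close to their limits, the test decides like the limiting test, up to a small
error in the level. -/
theorem adaptiveRejects_sandwich [Nonempty ι] {F₀ : ℝ → ℝ} {S : Fin W → (Fin L → ℝ) → ℝ}
    (hS : ∀ w, LipschitzWith 1 (S w)) {H : ι → Fin L → ℝ} {t : Fin L → ℝ} {G : Fin W → ℝ → ℝ}
    {Q : ℝ → ℝ} {a b ε δ η C D α : ℝ} (hε : 0 ≤ ε) (hη : 0 ≤ η) (hC : 0 ≤ C)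
    (hq : ∀ x ∈ Set.Icc a b, ∀ p, |p - F₀ x| ≤ δ → |quantile F₀ p - x| ≤ ε)
    (hF : ∀ x, |ecdf (fun p : ι × Fin L => H p.1 p.2) x - F₀ x|
      + 1 / (2 * (Fintype.card ι : ℝ) * (L : ℝ)) ≤ δ)
    (hbad : freq (fun i => ∃ l, H i l ∉ Set.Icc a b) ≤ η)
    (hG : ∀ w x, |ecdf (fun i => S w (H i)) x - G w x| ≤ η)
    (hQ : ∀ x, |ecdf (fun i => maxStat G S (H i)) x - Q x| ≤ η)
    (hGL : ∀ w x y, |G w x - G w y| ≤ C * |x - y|) (hQL : ∀ x y, |Q x - Q y| ≤ D * |x - y|)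
    (hα : α ∈ Set.Ioo (0 : ℝ) 1) :
    (AdaptiveRejects F₀ S α t H →
      1 - α - 2 * (η + D * (2 * η + 2 * C * ε)) ≤ Q (maxStat G S t)) ∧
    (¬ AdaptiveRejects F₀ S α t H →
      Q (maxStat G S t) ≤ 1 - α + 2 * (η + D * (2 * η + 2 * C * ε))) := by
  set Ht := rankTransform F₀ H
  have hD : 0 ≤ D := by simpa using (abs_nonneg _).trans (hQL 0 1)
  have hCε : 0 ≤ C * ε := by positivity
  have hclose : ∀ i, ¬ (∃ l, H i l ∉ Set.Icc a b) → ∀ w, |S w (Ht i) - S w (H i)| ≤ ε := by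
    intro i hi w
    push Not at hi
    have h1 := (hS w).dist_le_mul (Ht i) (H i)
    rw [NNReal.coe_one, one_mul, Real.dist_eq] at h1
    refine h1.trans ((dist_pi_le_iff hε).2 fun l => ?_)
    rw [Real.dist_eq]
    exact abs_rankTransform_sub_le hq hF (hi l)
  have hGt : ∀ w x, |aggEcdf S Ht w x - G w x| ≤ 2 * η + C * ε := by
    intro w x
    have := abs_ecdf_sub_le_of_close (fun i hi => hclose i hi w) hbad hε (hG w) (hGL w) x
    rw [two_mul]
    exact this
  -- `2η + Cε` pays for replacing the empirical `G̃ʷ` by `Gʷ`, and the other `Cε` for moving its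
  -- argument from the transformed row to the original one.
  set ρ := 2 * η + 2 * C * ε with hρ
  have hρ0 : 0 ≤ ρ := by rw [hρ, mul_assoc]; positivity
  have hR : ∀ i, ¬ (∃ l, H i l ∉ Set.Icc a b) →
      |maxStat (aggEcdf S Ht) S (Ht i) - maxStat G S (H i)| ≤ ρ := by
    intro i hi
    refine abs_maxStat_sub_le fun w => ?_
    have h1 := hGt w (S w (Ht i))
    have h2 := (hGL w (S w (Ht i)) (S w (H i))).trans
      (mul_le_mul_of_nonneg_left (hclose i hi w) hC)
    have h3 := abs_sub_le (aggEcdf S Ht w (S w (Ht i))) (G w (S w (Ht i))) (G w (S w (H i)))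
    rw [hρ]
    linarith
  have hQt : ∀ x, |adaptiveEcdf S Ht x - Q x| ≤ η + η + D * ρ :=
    abs_ecdf_sub_le_of_close hR hbad hρ0 hQ hQL
  have hRt : |maxStat (aggEcdf S Ht) S t - maxStat G S t| ≤ ρ := by
    refine (abs_maxStat_sub_le fun w => hGt w (S w t)).trans ?_
    rw [hρ]; linarith
  set R := maxStat (aggEcdf S Ht) S t with hRdef
  have hQR : |Q R - Q (maxStat G S t)| ≤ D * ρ :=
    (hQL _ _).trans (mul_le_mul_of_nonneg_left hRt hD)
  have hQR := abs_le.1 hQR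
  constructor
  · intro hrej
    have h1 : 1 - α ≤ adaptiveEcdf S Ht R :=
      le_ecdf_of_quantile_lt (by linarith [hα.1]) hrej
    have h2 := abs_le.1 (hQt R)
    linarith
  · intro hrej
    have hrej' : R ≤ quantile (adaptiveEcdf S Ht) (1 - α) := not_lt.1 hrej
    -- Acceptance controls the empirical distribution function only strictly to the left of `R`; the
    -- Lipschitz bound on `Q` pays for the gap `γ`, which then tends to `0`.
    have h1 : ∀ γ > 0, Q R ≤ 1 - α + (η + η + D * ρ) + D * γ := by
      intro γ hγ
      have h2 : adaptiveEcdf S Ht (R - γ) < 1 - α :=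
        ecdf_lt_of_le_quantile (by linarith [hα.2]) hrej' (by linarith)
      have h3 := abs_le.1 (hQt (R - γ))
      have h4 := hQL R (R - γ)
      rw [sub_sub_cancel, abs_of_pos hγ] at h4
      linarith [(abs_le.1 h4).2]
    have h5 : Q R ≤ 1 - α + (η + η + D * ρ) := by
      refine le_of_forall_pos_le_add fun e he => ?_
      refine (h1 (e / (D + 1)) (by positivity)).trans ?_
      have : D * (e / (D + 1)) ≤ e := by
        rw [mul_div_assoc', div_le_iff₀ (by positivity)]
        nlinarith
      linarith
    linarith

end Deterministic

/-! ### The probability integral transform, approximately -/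

section IntegralTransform

variable {Ω : Type*} [MeasurableSpace Ω] {μ : Measure Ω} [IsProbabilityMeasure μ] {Y : Ω → ℝ}
  {G : ℝ → ℝ} {δ : ℝ}

/-- By continuity, `{G ≤ u}` is a closed half-line whose endpoint still satisfies `G ≤ u`, when it
is neither empty nor everything; strict monotonicity is not needed. The `max` covers negative `u`.
-/
theorem measureReal_transform_le (hF : ∀ x, |μ.real {ω | Y ω ≤ x} - G x| ≤ δ)
    (hc : Continuous G) (hm : Monotone G) (h1 : Tendsto G atTop (𝓝 1)) (u : ℝ) :
    μ.real {ω | G (Y ω) ≤ u} ≤ max u 0 + δ := by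
  have hδ : 0 ≤ δ := (abs_nonneg _).trans (hF 0)
  have hm0 := le_max_right u 0
  rcases le_or_gt 1 u with hu | hu
  · exact measureReal_le_one.trans (by linarith [le_max_left u 0])
  obtain ⟨M, hM⟩ := (h1.eventually (lt_mem_nhds hu)).exists
  have hbdd : BddAbove {y | G y ≤ u} := ⟨M, fun y hy => (hm.reflect_lt (lt_of_le_of_lt hy hM)).le⟩
  rcases {y | G y ≤ u}.eq_empty_or_nonempty with he | hne
  · have : {ω | G (Y ω) ≤ u} = ∅ := Set.eq_empty_of_forall_notMem fun ω hω => by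
      have : Y ω ∈ {y | G y ≤ u} := hω
      rwa [he] at this
    rw [this, measureReal_empty]
    linarith
  · have hmem : G (sSup {y | G y ≤ u}) ≤ u :=
      (isClosed_le hc continuous_const).csSup_mem hne hbdd
    have hsub : {ω | G (Y ω) ≤ u} ⊆ {ω | Y ω ≤ sSup {y | G y ≤ u}} :=
      fun ω hω => le_csSup hbdd hω
    have h2 := measureReal_mono (μ := μ) hsub
    have h3 := abs_le.1 (hF (sSup {y | G y ≤ u}))
    linarith [le_max_left u 0]

theorem measureReal_le_transform (hY : Measurable Y) (hF : ∀ x, |μ.real {ω | Y ω ≤ x} - G x| ≤ δ)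
    (hc : Continuous G) (hm : Monotone G) (h0 : Tendsto G atBot (𝓝 0)) (u : ℝ) :
    μ.real {ω | u ≤ G (Y ω)} ≤ 1 - min u 1 + δ := by
  have hδ : 0 ≤ δ := (abs_nonneg _).trans (hF 0)
  have hm1 := min_le_right u 1
  have hmu := min_le_left u 1
  rcases le_or_gt u 0 with hu | hu
  · exact measureReal_le_one.trans (by linarith)
  obtain ⟨M, hM⟩ := (h0.eventually (gt_mem_nhds hu)).exists
  have hbdd : BddBelow {y | u ≤ G y} := ⟨M, fun y hy => (hm.reflect_lt (lt_of_lt_of_le hM hy)).le⟩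
  rcases {y | u ≤ G y}.eq_empty_or_nonempty with he | hne
  · have : {ω | u ≤ G (Y ω)} = ∅ := Set.eq_empty_of_forall_notMem fun ω hω => by
      have : Y ω ∈ {y | u ≤ G y} := hω
      rwa [he] at this
    rw [this, measureReal_empty]
    linarith
  · set c := sInf {y | u ≤ G y} with hcdef
    have hmem : u ≤ G c := (isClosed_le continuous_const hc).csInf_mem hne hbdd
    -- The hypothesis concerns `Y ≤ y`, whereas the event is contained in `c ≤ Y`; so `c` is
    -- approached from the left, and continuity of `G` gives the limit.
    have key : ∀ y < c, μ.real {ω | u ≤ G (Y ω)} ≤ 1 - G y + δ := by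
      intro y hy
      have hsub : {ω | u ≤ G (Y ω)} ⊆ {ω | Y ω ≤ y}ᶜ := fun ω hω hω' =>
        absurd (csInf_le hbdd hω) (not_le.2 (lt_of_le_of_lt hω' hy))
      have h2 := measureReal_mono (μ := μ) hsub
      rw [probReal_compl_eq_one_sub (measurableSet_le hY measurable_const)] at h2
      have h3 := abs_le.1 (hF y)
      linarith
    have hlim : Tendsto (fun y => 1 - G y + δ) (𝓝[<] c) (𝓝 (1 - G c + δ)) :=
      ((continuous_const.sub hc).add continuous_const).continuousAt.continuousWithinAt
    have := ge_of_tendsto hlim (eventually_nhdsWithin_of_forall key)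
    linarith

theorem measureReal_transform_mem_Ioc_le (hY : Measurable Y)
    (hF : ∀ x, |μ.real {ω | Y ω ≤ x} - G x| ≤ δ)
    (hc : Continuous G) (hm : Monotone G) (h0 : Tendsto G atBot (𝓝 0))
    (h1 : Tendsto G atTop (𝓝 1)) {x y : ℝ} (hxy : x ≤ y) :
    μ.real {ω | G (Y ω) ∈ Set.Ioc x y} ≤ y - x + 2 * δ := by
  have hδ : 0 ≤ δ := (abs_nonneg _).trans (hF 0)
  have hG0 : ∀ z, 0 ≤ G z := hm.le_of_tendsto h0
  have hG1 : ∀ z, G z ≤ 1 := hm.ge_of_tendsto h1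
  have hempty : (∀ z, G z ∉ Set.Ioc x y) → μ.real {ω | G (Y ω) ∈ Set.Ioc x y} ≤ y - x + 2 * δ := by
    intro h
    have : {ω | G (Y ω) ∈ Set.Ioc x y} = ∅ := Set.eq_empty_of_forall_notMem fun ω hω => h _ hω
    rw [this, measureReal_empty]
    linarith
  rcases lt_or_ge y 0 with hy | hy
  · exact hempty fun z hz => by linarith [hz.2, hG0 z]
  rcases lt_or_ge 1 x with hx | hx
  · exact hempty fun z hz => by linarith [hz.1, hG1 z]
  have hmeas : ∀ u, MeasurableSet {ω | G (Y ω) ≤ u} := fun u =>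
    measurableSet_le (hc.measurable.comp hY) measurable_const
  have hsub : {ω | G (Y ω) ∈ Set.Ioc x y} ⊆ {ω | G (Y ω) ≤ y} \ {ω | G (Y ω) ≤ x} :=
    fun ω hω => ⟨hω.2, not_le.2 hω.1⟩
  have h2 := measureReal_mono (μ := μ) hsub
  rw [measureReal_sdiff (show {ω | G (Y ω) ≤ x} ⊆ {ω | G (Y ω) ≤ y} from
    fun ω hω => le_trans hω hxy) (hmeas x)] at h2
  have h3 := measureReal_transform_le hF hc hm h1 y
  have h4 := measureReal_le_transform hY hF hc hm h0 x
  have h5 : {ω | G (Y ω) ≤ x}ᶜ ⊆ {ω | x ≤ G (Y ω)} := fun ω hω =>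
    (not_le.1 (show ¬ G (Y ω) ≤ x from hω)).le
  have h6 := measureReal_mono (μ := μ) h5
  rw [probReal_compl_eq_one_sub (hmeas x)] at h6
  rw [max_eq_left hy] at h3
  rw [min_eq_left hx] at h4
  linarith

end IntegralTransform

/-! ### Uniform convergence of distribution functions -/

section UniformConvergence

/-- A family of distribution functions which is uniformly Lipschitz and uniformly tight. -/
structure IsRegularFamily {Θ : Type*} (Θ₀ : Set Θ) (G : Θ → ℝ → ℝ) : Prop where
  monotone : ∀ P ∈ Θ₀, Monotone (G P)
  mem_Icc : ∀ P ∈ Θ₀, ∀ x, G P x ∈ Set.Icc (0 : ℝ) 1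
  lipschitz : ∃ C : ℝ, ∀ P ∈ Θ₀, ∀ x y, |G P x - G P y| ≤ C * |x - y|
  tight : ∀ ε > 0, ∃ M : ℝ, ∀ P ∈ Θ₀, G P (-M) ≤ ε ∧ 1 - ε ≤ G P M

/-- For a regular family, uniform closeness can be checked on a common finite grid. -/
theorem IsRegularFamily.exists_grid {Θ : Type*} {Θ₀ : Set Θ} {G : Θ → ℝ → ℝ}
    (hG : IsRegularFamily Θ₀ G) {ε : ℝ} (hε : 0 < ε) :
    ∃ s : Finset ℝ, ∀ P ∈ Θ₀, ∀ F : ℝ → ℝ, Monotone F → (∀ x, F x ∈ Set.Icc (0 : ℝ) 1) →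
      (∀ x ∈ s, |F x - G P x| ≤ ε / 2) → ∀ x, |F x - G P x| ≤ ε := by
  obtain ⟨C, hC⟩ := hG.lipschitz
  obtain ⟨M, hM⟩ := hG.tight (ε / 2) (by positivity)
  obtain ⟨s, hs⟩ := RankSub.exists_grid C M (ε := ε / 2) (by positivity)
  refine ⟨s, fun P hP F hF hF01 h x => ?_⟩
  have := hs F (G P) hF hF01 (hG.monotone P hP) (hG.mem_Icc P hP) (hC P hP) (hM P hP).1
    (hM P hP).2 h x
  linarith

theorem IsRegularFamily.eventually_forall_abs_sub_le {Θ : Type*} {Θ₀ : Set Θ} {G : Θ → ℝ → ℝ}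
    (hG : IsRegularFamily Θ₀ G) {F : ℕ → Θ → ℝ → ℝ} (hF : ∀ n P, Monotone (F n P))
    (hF01 : ∀ n P x, F n P x ∈ Set.Icc (0 : ℝ) 1)
    (h : ∀ x, TendstoUniformlyOn (fun n P => F n P x) (fun P => G P x) atTop Θ₀)
    {ε : ℝ} (hε : 0 < ε) : ∀ᶠ n in atTop, ∀ P ∈ Θ₀, ∀ x, |F n P x - G P x| ≤ ε := by
  obtain ⟨s, hs⟩ := hG.exists_grid hε
  have h1 : ∀ᶠ n in atTop, ∀ x ∈ s, ∀ P ∈ Θ₀, |F n P x - G P x| ≤ ε / 2 := by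
    rw [Filter.eventually_all_finset]
    intro x _
    filter_upwards [Metric.tendstoUniformlyOn_iff.1 (h x) (ε / 2) (by positivity)] with n hn P hP
    have := hn P hP
    rw [dist_comm, Real.dist_eq] at this
    exact this.le
  filter_upwards [h1] with n hn P hP
  exact hs P hP _ (hF n P) (hF01 n P) fun x hx => hn x hx P hP

variable {𝒳 E : Type*} [MeasurableSpace 𝒳] [MeasurableSpace E] (PΩ : Measure E)

theorem distFun_eq [IsProbabilityMeasure PΩ] (P : ProbabilityMeasure 𝒳) (n : ℕ) {Y : (Fin n → 𝒳) × E → ℝ}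
    (hY : Measurable Y) (x : ℝ) :
    distFun P PΩ n Y x = (dataLaw P PΩ n).real {ω | Y ω ≤ x} := by
  have := Measure.isProbabilityMeasure_map (μ := dataLaw P PΩ n) hY.aemeasurable
  rw [distFun, cdf_eq_real, map_measureReal_apply hY measurableSet_Iic]
  rfl

theorem monotone_distFun (P : ProbabilityMeasure 𝒳) (n : ℕ) (Y : (Fin n → 𝒳) × E → ℝ) :
    Monotone (distFun P PΩ n Y) := monotone_cdf _

theorem distFun_mem_Icc (P : ProbabilityMeasure 𝒳) (n : ℕ) (Y : (Fin n → 𝒳) × E → ℝ) (x : ℝ) :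
    distFun P PΩ n Y x ∈ Set.Icc (0 : ℝ) 1 := ⟨cdf_nonneg _ _, cdf_le_one _ _⟩

theorem tendsto_div_subsampleSize {m : ℕ → ℕ} (hm : Tendsto m atTop atTop)
    (hmn : Tendsto (fun n => (m n : ℝ) / n) atTop (𝓝 0)) :
    Tendsto (fun n => n / m n) atTop atTop := by
  rw [tendsto_atTop]
  intro c
  have h1 : ∀ᶠ n in atTop, (m n : ℝ) / n < 1 / (c + 1) :=
    hmn.eventually (gt_mem_nhds (by positivity))
  filter_upwards [h1, hm.eventually_ge_atTop 1, eventually_ge_atTop 1] with n hn hmn1 hn1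
  rw [Nat.le_div_iff_mul_le hmn1]
  have hn0 : (0 : ℝ) < n := by exact_mod_cast hn1
  rw [div_lt_div_iff₀ hn0 (by positivity), one_mul] at hn
  have : (c * m n : ℝ) ≤ n := by nlinarith [(Nat.cast_nonneg (m n) : (0 : ℝ) ≤ m n)]
  exact_mod_cast this

variable [IsProbabilityMeasure PΩ] {L : ℕ} {T : ∀ n, (Fin n → 𝒳) × E → Fin L → ℝ} {m : ℕ → ℕ} {J : ℕ}

-- The Chebyshev bound depends neither on the law nor on the event, which is what makes the
-- convergence uniform over the null hypothesis.
open Classical in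
theorem eventually_measureReal_freq_deviation_le (hT : ∀ n, Measurable (T n))
    (hK : Tendsto (fun n => n / m n) atTop atTop) (hJ : 1 ≤ J) {ε c : ℝ} (hε : 0 < ε) (hc : 0 < c) :
    ∀ᶠ n in atTop, ∀ P : ProbabilityMeasure 𝒳, ∀ A : Set (Fin L → ℝ), MeasurableSet A →
      (inputLaw P PΩ J n (m n)).real {I | ε ≤
        |freq (fun b => subsampleMatrix (T (m n)) I b ∈ A)
          - (dataLaw P PΩ (m n)).real (T (m n) ⁻¹' A)|} ≤ c := by
  have h1 : Tendsto (fun n => (J : ℝ) / (ε ^ 2 * (n / m n : ℕ))) atTop (𝓝 0) :=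
    (((tendsto_natCast_atTop_atTop (R := ℝ)).comp hK).const_mul_atTop
      (by positivity : (0 : ℝ) < ε ^ 2)).const_div_atTop _
  filter_upwards [h1.eventually (gt_mem_nhds hc), hK.eventually_ge_atTop 1] with n hn hn1 P A hA
  exact (measure_freq_deviation_le P PΩ hJ hn1 (hT (m n) hA) hε).trans hn.le

/-- The subsampling distribution function of a statistic converges in probability, uniformly. -/
theorem IsRegularFamily.eventually_measureReal_ecdf_le {𝒫₀ : Set (ProbabilityMeasure 𝒳)}
    {G : ProbabilityMeasure 𝒳 → ℝ → ℝ} (hG : IsRegularFamily 𝒫₀ G)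
    (hT : ∀ n, Measurable (T n)) (hm : Tendsto m atTop atTop)
    (hK : Tendsto (fun n => n / m n) atTop atTop) (hJ : 1 ≤ J)
    {V : ProbabilityMeasure 𝒳 → (Fin L → ℝ) → ℝ} (hV : ∀ P ∈ 𝒫₀, Measurable (V P))
    (h : ∀ x, TendstoUniformlyOn (fun n P => distFun P PΩ n (fun ω => V P (T n ω)) x)
      (fun P => G P x) atTop 𝒫₀) {ε c : ℝ} (hε : 0 < ε) (hc : 0 < c) :
    ∀ᶠ n in atTop, ∀ P ∈ 𝒫₀, (inputLaw P PΩ J n (m n)).real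
      {I | ¬ ∀ x, |ecdf (fun b => V P (subsampleMatrix (T (m n)) I b)) x - G P x| ≤ ε} ≤ c := by
  classical
  obtain ⟨s, hs⟩ := hG.exists_grid hε
  have h1 : ∀ᶠ n in atTop, ∀ x ∈ s, ∀ P ∈ 𝒫₀,
      |distFun P PΩ (m n) (fun ω => V P (T (m n) ω)) x - G P x| ≤ ε / 4 := by
    rw [Filter.eventually_all_finset]
    intro x _
    filter_upwards [hm.eventually
      (Metric.tendstoUniformlyOn_iff.1 (h x) (ε / 4) (by positivity))] with n hn P hP
    have := hn P hP
    rw [dist_comm, Real.dist_eq] at this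
    exact this.le
  -- The grid tolerance `ε / 2` is split between the random fluctuation and the bias at sample size
  -- `m n`. The `+ 1` allows an empty grid.
  filter_upwards [h1, eventually_measureReal_freq_deviation_le PΩ hT hK hJ (ε := ε / 4)
    (c := c / (s.card + 1)) (by positivity) (by positivity)] with n hn hn' P hP
  have hsub : {I | ¬ ∀ x, |ecdf (fun b => V P (subsampleMatrix (T (m n)) I b)) x - G P x| ≤ ε}
      ⊆ ⋃ x ∈ s, {I : Inputs 𝒳 E J n (m n) | ε / 4 ≤
        |freq (fun b => subsampleMatrix (T (m n)) I b ∈ {t | V P t ≤ x})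
          - (dataLaw P PΩ (m n)).real (T (m n) ⁻¹' {t | V P t ≤ x})|} := by
    intro I hI
    by_contra hcon
    refine hI (hs P hP _ (monotone_ecdf _) (ecdf_mem_Icc _) fun x hx => ?_)
    simp only [Set.mem_iUnion, Set.mem_ofPred_eq, not_exists, not_le] at hcon
    have h2 := hcon x hx
    have h3 := hn x hx P hP
    rw [distFun_eq PΩ P _ (Y := fun ω => V P (T (m n) ω)) ((hV P hP).comp (hT _))] at h3
    have h4 := abs_sub_le (ecdf (fun b => V P (subsampleMatrix (T (m n)) I b)) x)
      ((dataLaw P PΩ (m n)).real (T (m n) ⁻¹' {t | V P t ≤ x})) (G P x)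
    have h5 : freq (fun b => V P (subsampleMatrix (T (m n)) I b) ≤ x)
        = ecdf (fun b => V P (subsampleMatrix (T (m n)) I b)) x := by
      unfold freq ecdf
      congr!
    rw [h5] at h2
    have h6 : (dataLaw P PΩ (m n)).real (T (m n) ⁻¹' {t | V P t ≤ x})
      = (dataLaw P PΩ (m n)).real {ω | V P (T (m n) ω) ≤ x} := rfl
    rw [h6] at h2 h4
    linarith
  refine (measureReal_mono hsub (measure_ne_top _ _)).trans ((measureReal_biUnion_finset_le _ _).trans ?_)
  calc _ ≤ ∑ _x ∈ s, c / (s.card + 1) := Finset.sum_le_sum fun x _ =>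
        hn' P _ (measurableSet_le (hV P hP) measurable_const)
    _ = s.card * (c / (s.card + 1)) := by simp
    _ ≤ c := by
        rw [mul_div_assoc', div_le_iff₀ (by positivity)]
        nlinarith

end UniformConvergence

/-! ### Regularity of the limiting distribution functions -/

section Limits

theorem isRegularFamily_const {Θ : Type*} (Θ₀ : Set Θ) (μ₀ : Measure ℝ) [IsProbabilityMeasure μ₀]
    {C : ℝ} (hC : ∀ x y, |cdf μ₀ x - cdf μ₀ y| ≤ C * |x - y|) :
    IsRegularFamily Θ₀ fun _ => cdf μ₀ where
  monotone _ _ := monotone_cdf _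
  mem_Icc _ _ x := ⟨cdf_nonneg _ x, cdf_le_one _ x⟩
  lipschitz := ⟨C, fun _ _ => hC⟩
  tight ε hε := by
    have h1 := ((tendsto_cdf_atBot μ₀).comp tendsto_neg_atTop_atBot).eventually
      (gt_mem_nhds hε)
    have h2 := (tendsto_cdf_atTop μ₀).eventually (lt_mem_nhds (sub_lt_self 1 hε))
    obtain ⟨M, hM1, hM2⟩ := (h1.and h2).exists
    exact ⟨M, fun _ _ => ⟨hM1.le, hM2.le⟩⟩

theorem continuous_of_abs_sub_le {f : ℝ → ℝ} {C : ℝ} (h : ∀ x y, |f x - f y| ≤ C * |x - y|) :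
    Continuous f := by
  have hC : 0 ≤ C := by simpa using (abs_nonneg _).trans (h 0 1)
  exact (LipschitzWith.of_dist_le_mul (K := ⟨C, hC⟩) fun x y => h x y).continuous

theorem continuous_maxStat {L W : ℕ} [NeZero W] {G : Fin W → ℝ → ℝ} {S : Fin W → (Fin L → ℝ) → ℝ}
    (hG : ∀ w, Continuous (G w)) (hS : ∀ w, Continuous (S w)) : Continuous (maxStat G S) :=
  Continuous.finset_sup'_apply _ fun w _ => (hG w).comp (hS w)

variable {𝒳 E : Type*} [MeasurableSpace 𝒳] [MeasurableSpace E] (PΩ : Measure E) {L W : ℕ} [NeZero W]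
  {T : ∀ n, (Fin n → 𝒳) × E → Fin L → ℝ}

theorem distFun_coord_eq [NeZero L] (hT : ∀ n, Measurable (T n)) {P : ProbabilityMeasure 𝒳} {n : ℕ}
    (h : Exchangeable (dataLaw P PΩ n) (T n)) (l : Fin L) :
    distFun P PΩ n (fun ω => T n ω l) = distFun P PΩ n fun ω => T n ω 0 := by
  have h1 := congrArg (Measure.map fun t : Fin L → ℝ => t 0) (h (Equiv.swap 0 l))
  rw [Measure.map_map (by fun_prop)
    (show Measurable fun ω i => T n ω (Equiv.swap 0 l i) from
      measurable_pi_lambda _ fun i => (measurable_pi_apply _).comp (hT n)), Measure.map_map (by fun_prop) (hT n)] at h1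
  simp only [Function.comp_def, Equiv.swap_apply_left] at h1
  funext x
  rw [distFun, distFun, h1]

variable [IsProbabilityMeasure PΩ]

theorem measureReal_exists_notMem_Icc_le [NeZero L] (hT : ∀ n, Measurable (T n)) {P : ProbabilityMeasure 𝒳}
    {n : ℕ} (h : Exchangeable (dataLaw P PΩ n) (T n)) (a b : ℝ) :
    (dataLaw P PΩ n).real {ω | ∃ l, T n ω l ∉ Set.Icc a b}
      ≤ L * (distFun P PΩ n (fun ω => T n ω 0) a
        + (1 - distFun P PΩ n (fun ω => T n ω 0) b)) := by
  have hTl : ∀ l, Measurable fun ω => T n ω l := fun l => (measurable_pi_apply l).comp (hT n)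
  have hsub : {ω | ∃ l, T n ω l ∉ Set.Icc a b}
      ⊆ ⋃ l, ({ω | T n ω l ≤ a} ∪ {ω | T n ω l ≤ b}ᶜ) := by
    rintro ω ⟨l, hl⟩
    refine Set.mem_iUnion.2 ⟨l, ?_⟩
    by_contra hcon
    simp only [Set.mem_union, Set.mem_compl_iff, Set.mem_ofPred_eq, not_or, not_le] at hcon
    exact hl ⟨hcon.1.le, not_lt.1 hcon.2⟩
  refine (measureReal_mono hsub).trans ((measureReal_iUnion_fintype_le _).trans ?_)
  calc _ ≤ ∑ _l : Fin L, (distFun P PΩ n (fun ω => T n ω 0) a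
        + (1 - distFun P PΩ n (fun ω => T n ω 0) b)) := by
        refine Finset.sum_le_sum fun l _ => (measureReal_union_le _ _).trans ?_
        rw [probReal_compl_eq_one_sub (measurableSet_le (hTl l) measurable_const),
          ← distFun_eq PΩ P n (hTl l), ← distFun_eq PΩ P n (hTl l), distFun_coord_eq PΩ hT h l]
    _ = _ := by
        simp only [Finset.sum_const, Finset.card_univ, Fintype.card_fin, nsmul_eq_mul]

/-- Uniform tightness of the limits is inherited from the pivot. All coordinates share a limit law
free of `P`, so a union bound puts them in `[-M, M]` with high probability, and there a
`1`-Lipschitz `S` stays within `M` of `S 0`. -/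
theorem isRegularFamily_aggregate [NeZero L] {𝒫₀ : Set (ProbabilityMeasure 𝒳)} (hT : ∀ n, Measurable (T n))
    (hexch : ∀ P ∈ 𝒫₀, ∀ n, 1 ≤ n → Exchangeable (dataLaw P PΩ n) (T n))
    (μ₀ : Measure ℝ) [IsProbabilityMeasure μ₀]
    (hF : ∀ x, TendstoUniformlyOn (fun n P => distFun P PΩ n (fun ω => T n ω 0) x)
      (fun _ => cdf μ₀ x) atTop 𝒫₀)
    {S : (Fin L → ℝ) → ℝ} (hS : LipschitzWith 1 S)
    {G : ProbabilityMeasure 𝒳 → ProbabilityMeasure ℝ} {C : ℝ}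
    (hC : ∀ P ∈ 𝒫₀, ∀ x y, |cdf (G P : Measure ℝ) x - cdf (G P : Measure ℝ) y| ≤ C * |x - y|)
    (hG : ∀ x, TendstoUniformlyOn (fun n P => distFun P PΩ n (fun ω => S (T n ω)) x)
      (fun P => cdf (G P : Measure ℝ) x) atTop 𝒫₀) :
    IsRegularFamily 𝒫₀ fun P => cdf (G P : Measure ℝ) where
  monotone _ _ := monotone_cdf _
  mem_Icc _ _ x := ⟨cdf_nonneg _ x, cdf_le_one _ x⟩
  lipschitz := ⟨C, hC⟩
  tight ε hε := by
    have hL : (0 : ℝ) < L := by exact_mod_cast Nat.pos_of_ne_zero (NeZero.ne L)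
    have hε' : 0 < ε / (2 * L) := by positivity
    have h1 := ((tendsto_cdf_atBot μ₀).comp tendsto_neg_atTop_atBot).eventually
      (gt_mem_nhds hε')
    have h2 := (tendsto_cdf_atTop μ₀).eventually (lt_mem_nhds (sub_lt_self 1 hε'))
    obtain ⟨M, hM1, hM2, hM0⟩ := (h1.and (h2.and (eventually_ge_atTop 0))).exists
    have hbound : L * (cdf μ₀ (-M) + (1 - cdf μ₀ M)) ≤ ε := by
      have : cdf μ₀ (-M) + (1 - cdf μ₀ M) ≤ ε / (2 * L) + ε / (2 * L) := by
        simp only [Function.comp] at hM1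
        linarith
      calc L * (cdf μ₀ (-M) + (1 - cdf μ₀ M)) ≤ L * (ε / (2 * L) + ε / (2 * L)) := by gcongr
        _ = ε := by field_simp; ring
    refine ⟨|S 0| + M + 1, fun P hP => ?_⟩
    have hlim : Tendsto (fun n => L * (distFun P PΩ n (fun ω => T n ω 0) (-M)
        + (1 - distFun P PΩ n (fun ω => T n ω 0) M))) atTop
        (𝓝 (L * (cdf μ₀ (-M) + (1 - cdf μ₀ M)))) :=
      (((hF (-M)).tendsto_at hP).add (((hF M).tendsto_at hP).const_sub 1)).const_mul _
    have hST : ∀ n, Measurable fun ω => S (T n ω) := fun n => hS.continuous.measurable.comp (hT n)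
    have hclose : ∀ n ω, (∀ l, T n ω l ∈ Set.Icc (-M) M) → |S (T n ω) - S 0| ≤ M := by
      intro n ω h
      have h1 := hS.dist_le_mul (T n ω) 0
      rw [NNReal.coe_one, one_mul, Real.dist_eq] at h1
      refine h1.trans ((dist_pi_le_iff hM0).2 fun l => ?_)
      rw [Real.dist_eq, Pi.zero_apply, sub_zero]
      exact abs_le.2 (h l)
    constructor
    · refine le_trans (le_of_tendsto_of_tendsto ((hG _).tendsto_at hP) hlim ?_) hbound
      filter_upwards [eventually_ge_atTop 1] with n hn
      rw [distFun_eq PΩ P n (hST n)]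
      refine le_trans (measureReal_mono ?_)
        (measureReal_exists_notMem_Icc_le PΩ hT (hexch P hP n hn) (-M) M)
      intro ω hω
      by_contra hcon
      have h3 := abs_le.1 (hclose n ω (by simpa using hcon))
      have h4 : S (T n ω) ≤ -(|S 0| + M + 1) := hω
      linarith [neg_abs_le (S 0)]
    · have : 1 - cdf (G P : Measure ℝ) (|S 0| + M + 1) ≤ L * (cdf μ₀ (-M) + (1 - cdf μ₀ M)) := by
        refine le_of_tendsto_of_tendsto (((hG _).tendsto_at hP).const_sub 1) hlim ?_
        filter_upwards [eventually_ge_atTop 1] with n hn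
        rw [distFun_eq PΩ P n (hST n),
          ← probReal_compl_eq_one_sub (measurableSet_le (hST n) measurable_const)]
        refine le_trans (measureReal_mono ?_)
          (measureReal_exists_notMem_Icc_le PΩ hT (hexch P hP n hn) (-M) M)
        intro ω hω
        by_contra hcon
        have h3 := abs_le.1 (hclose n ω (by simpa using hcon))
        refine hω (show S (T n ω) ≤ |S 0| + M + 1 from ?_)
        linarith [le_abs_self (S 0)]
      linarith

/-- The limit law of the maximum of the transformed statistics is `W`-Lipschitz, since each of the
transformed statistics is asymptotically uniform. -/
theorem isRegularFamily_maxStat {𝒫₀ : Set (ProbabilityMeasure 𝒳)} (hT : ∀ n, Measurable (T n))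
    {S : Fin W → (Fin L → ℝ) → ℝ} (hS : ∀ w, LipschitzWith 1 (S w))
    {G : ProbabilityMeasure 𝒳 → Fin W → ProbabilityMeasure ℝ}
    (hreg : ∀ w, IsRegularFamily 𝒫₀ fun P => cdf (G P w : Measure ℝ))
    (hG : ∀ w x, TendstoUniformlyOn (fun n P => distFun P PΩ n (fun ω => S w (T n ω)) x)
      (fun P => cdf (G P w : Measure ℝ) x) atTop 𝒫₀)
    {Q : ProbabilityMeasure 𝒳 → ProbabilityMeasure ℝ}
    (hQ : ∀ x, TendstoUniformlyOn (fun n P => distFun P PΩ n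
      (fun ω => maxStat (fun w => cdf (G P w : Measure ℝ)) S (T n ω)) x)
        (fun P => cdf (Q P : Measure ℝ) x) atTop 𝒫₀) :
    (∀ P ∈ 𝒫₀, ∀ x y, |cdf (Q P : Measure ℝ) x - cdf (Q P : Measure ℝ) y| ≤ W * |x - y|) ∧
      IsRegularFamily 𝒫₀ fun P => cdf (Q P : Measure ℝ) := by
  have hGc : ∀ P ∈ 𝒫₀, ∀ w, Continuous (cdf (G P w : Measure ℝ)) := fun P hP w => by
    obtain ⟨C, hC⟩ := (hreg w).lipschitz
    exact continuous_of_abs_sub_le (hC P hP)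
  have hR : ∀ P ∈ 𝒫₀, ∀ n,
      Measurable fun ω => maxStat (fun w => cdf (G P w : Measure ℝ)) S (T n ω) := fun P hP n =>
    (continuous_maxStat (hGc P hP) fun w => (hS w).continuous).measurable.comp (hT n)
  have hLip : ∀ P ∈ 𝒫₀, ∀ x y, x ≤ y →
      cdf (Q P : Measure ℝ) y - cdf (Q P : Measure ℝ) x ≤ W * (y - x) := by
    intro P hP x y hxy
    have hW : (0 : ℝ) < W := by exact_mod_cast Nat.pos_of_ne_zero (NeZero.ne W)
    refine le_of_forall_pos_le_add fun e he => ?_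
    refine le_of_tendsto (((hQ y).tendsto_at hP).sub ((hQ x).tendsto_at hP)) ?_
    have hunif : ∀ᶠ n in atTop, ∀ w, ∀ P ∈ 𝒫₀, ∀ x,
        |distFun P PΩ n (fun ω => S w (T n ω)) x - cdf (G P w : Measure ℝ) x| ≤ e / (2 * W) :=
      eventually_all.2 fun w => (hreg w).eventually_forall_abs_sub_le
        (fun n P => monotone_distFun PΩ P n _) (fun n P => distFun_mem_Icc PΩ P n _) (hG w)
        (by positivity)
    filter_upwards [hunif] with n hn
    have hS' : ∀ w, Measurable fun ω => S w (T n ω) := fun w =>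
      (hS w).continuous.measurable.comp (hT n)
    rw [distFun_eq PΩ P n (hR P hP n), distFun_eq PΩ P n (hR P hP n),
      ← measureReal_sdiff
        (show {ω | maxStat (fun w => cdf (G P w : Measure ℝ)) S (T n ω) ≤ x}
          ⊆ {ω | maxStat (fun w => cdf (G P w : Measure ℝ)) S (T n ω) ≤ y}
          from fun ω hω => le_trans hω hxy)
        (measurableSet_le (hR P hP n) measurable_const)]
    -- If the maximum lies in `(x, y]`, so does some transformed coordinate. The union bound over
    -- `w` produces the Lipschitz constant `W`, whatever the dependence between the coordinates.
    have hsub : {ω | maxStat (fun w => cdf (G P w : Measure ℝ)) S (T n ω) ≤ y} \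
        {ω | maxStat (fun w => cdf (G P w : Measure ℝ)) S (T n ω) ≤ x} ⊆
        ⋃ w, {ω | cdf (G P w : Measure ℝ) (S w (T n ω)) ∈ Set.Ioc x y} := by
      rintro ω ⟨h1, h2⟩
      have h1 : maxStat (fun w => cdf (G P w : Measure ℝ)) S (T n ω) ≤ y := h1
      have h2 : ¬ maxStat (fun w => cdf (G P w : Measure ℝ)) S (T n ω) ≤ x := h2
      rw [maxStat, Finset.sup'_le_iff] at h1 h2
      push Not at h2
      obtain ⟨w, hw, h3⟩ := h2
      exact Set.mem_iUnion.2 ⟨w, h3, h1 w hw⟩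
    refine (measureReal_mono hsub).trans ((measureReal_iUnion_fintype_le _).trans ?_)
    calc _ ≤ ∑ _w : Fin W, (y - x + 2 * (e / (2 * W))) := by
          refine Finset.sum_le_sum fun w _ => measureReal_transform_mem_Ioc_le (hS' w)
            (fun z => ?_) (hGc P hP w) (monotone_cdf _) (tendsto_cdf_atBot _)
            (tendsto_cdf_atTop _) hxy
          rw [← distFun_eq PΩ P n (hS' w)]
          exact hn w P hP z
      _ = W * (y - x) + e := by
          simp only [Finset.sum_const, Finset.card_univ, Fintype.card_fin, nsmul_eq_mul]
          field_simp
  have hLip' : ∀ P ∈ 𝒫₀, ∀ x y,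
      |cdf (Q P : Measure ℝ) x - cdf (Q P : Measure ℝ) y| ≤ W * |x - y| := by
    intro P hP x y
    wlog hxy : x ≤ y generalizing x y
    · rw [abs_sub_comm, abs_sub_comm x]
      exact this y x (le_of_not_ge hxy)
    rw [abs_sub_comm, abs_sub_comm x, abs_of_nonneg (sub_nonneg.2 (monotone_cdf _ hxy)),
      abs_of_nonneg (sub_nonneg.2 hxy)]
    exact hLip P hP x y hxy
  refine ⟨hLip', fun _ _ => monotone_cdf _, fun _ _ x => ⟨cdf_nonneg _ x, cdf_le_one _ x⟩,
    ⟨W, hLip'⟩, fun ε hε => ⟨1, fun P hP => ⟨?_, ?_⟩⟩⟩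
  · refine le_of_tendsto ((hQ (-1)).tendsto_at hP) (Eventually.of_forall fun n => ?_)
    rw [distFun_eq PΩ P n (hR P hP n)]
    have : {ω | maxStat (fun w => cdf (G P w : Measure ℝ)) S (T n ω) ≤ -1} = ∅ := by
      refine Set.eq_empty_of_forall_notMem fun ω hω => ?_
      have h1 : maxStat (fun w => cdf (G P w : Measure ℝ)) S (T n ω) ≤ -1 := hω
      rw [maxStat, Finset.sup'_le_iff] at h1
      linarith [h1 0 (Finset.mem_univ _), cdf_nonneg (G P 0 : Measure ℝ) (S 0 (T n ω))]
    rw [this, measureReal_empty]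
    exact hε.le
  · refine ge_of_tendsto ((hQ 1).tendsto_at hP) (Eventually.of_forall fun n => ?_)
    rw [distFun_eq PΩ P n (hR P hP n)]
    have : {ω | maxStat (fun w => cdf (G P w : Measure ℝ)) S (T n ω) ≤ 1} = Set.univ := by
      refine Set.eq_univ_of_forall fun ω => ?_
      exact Finset.sup'_le _ _ fun w _ => cdf_le_one _ _
    rw [this, probReal_univ]
    linarith

end Limits

/-! ### Asymptotic level of the adaptive test -/

section Level

theorem ecdf_prod_eq {ι : Type*} [Fintype ι] {L : ℕ} (H : ι → Fin L → ℝ) (x : ℝ) :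
    ecdf (fun p : ι × Fin L => H p.1 p.2) x = (∑ l, ecdf (fun i => H i l) x) / L := by
  simp only [ecdf, Finset.card_filter, Fintype.card_prod, Fintype.card_fin, Nat.cast_sum,
    Fintype.sum_prod_type_right, ← Finset.sum_div, Nat.cast_mul, div_div]

theorem abs_ecdf_prod_sub_le {ι : Type*} [Fintype ι] {L : ℕ} [NeZero L] {H : ι → Fin L → ℝ}
    {x y δ : ℝ} (h : ∀ l, |ecdf (fun i => H i l) x - y| ≤ δ) :
    |ecdf (fun p : ι × Fin L => H p.1 p.2) x - y| ≤ δ := by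
  have hL : (0 : ℝ) < L := by exact_mod_cast Nat.pos_of_ne_zero (NeZero.ne L)
  have : ecdf (fun p : ι × Fin L => H p.1 p.2) x - y
      = (∑ l, (ecdf (fun i => H i l) x - y)) / L := by
    rw [ecdf_prod_eq, Finset.sum_sub_distrib]
    simp only [Finset.sum_const, Finset.card_univ, Fintype.card_fin, nsmul_eq_mul]
    field_simp
  rw [this, abs_div, abs_of_pos hL, div_le_iff₀ hL]
  calc _ ≤ ∑ l, |ecdf (fun i => H i l) x - y| := Finset.abs_sum_le_sum_abs _ _
    _ ≤ ∑ _l : Fin L, δ := Finset.sum_le_sum fun l _ => h l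
    _ = δ * L := by
      simp only [Finset.sum_const, Finset.card_univ, Fintype.card_fin, nsmul_eq_mul, mul_comm]

variable {𝒳 E : Type*} [MeasurableSpace 𝒳] [MeasurableSpace E] (PΩ : Measure E)
  [IsProbabilityMeasure PΩ] {L W : ℕ} [NeZero L] [NeZero W]
  {T : ∀ n, (Fin n → 𝒳) × E → Fin L → ℝ} {m : ℕ → ℕ} {J : ℕ}

open Classical in
/-- Few rows of the subsampling matrix have an entry outside a large compact interval. -/
theorem eventually_measureReal_badRows_le {𝒫₀ : Set (ProbabilityMeasure 𝒳)}
    (hT : ∀ n, Measurable (T n))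
    (hexch : ∀ P ∈ 𝒫₀, ∀ n, 1 ≤ n → Exchangeable (dataLaw P PΩ n) (T n))
    (hm : Tendsto m atTop atTop) (hK : Tendsto (fun n => n / m n) atTop atTop) (hJ : 1 ≤ J)
    {F₀ : ℝ → ℝ} (hF : ∀ x, TendstoUniformlyOn (fun n P => distFun P PΩ n (fun ω => T n ω 0) x)
      (fun _ => F₀ x) atTop 𝒫₀) {a b η c : ℝ} (hη : 0 < η) (hc : 0 < c)
    (ha : F₀ a ≤ η / (8 * L)) (hb : 1 - F₀ b ≤ η / (8 * L)) :
    ∀ᶠ n in atTop, ∀ P ∈ 𝒫₀, (inputLaw P PΩ J n (m n)).real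
      {I | ¬ freq (fun i => ∃ l, subsampleMatrix (T (m n)) I i l ∉ Set.Icc a b) ≤ η} ≤ c := by
  have hL : (0 : ℝ) < L := by exact_mod_cast Nat.pos_of_ne_zero (NeZero.ne L)
  have hclose : ∀ x, ∀ᶠ n in atTop, ∀ P ∈ 𝒫₀,
      |distFun P PΩ (m n) (fun ω => T (m n) ω 0) x - F₀ x| ≤ η / (8 * L) := fun x => by
    filter_upwards [hm.eventually
      (Metric.tendstoUniformlyOn_iff.1 (hF x) (η / (8 * L)) (by positivity))] with n hn P hP
    have := hn P hP
    rw [dist_comm, Real.dist_eq] at this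
    exact this.le
  filter_upwards [hclose a, hclose b, hm.eventually_ge_atTop 1,
    eventually_measureReal_freq_deviation_le PΩ hT hK hJ (ε := η / 2) (by positivity) hc]
    with n hna hnb hn1 hn P hP
  obtain ⟨A, hA⟩ : ∃ A : Set (Fin L → ℝ), A = {t | ∃ l, t l ∉ Set.Icc a b} := ⟨_, rfl⟩
  have hAm : MeasurableSet A := by
    have : A = ⋃ l, (fun t : Fin L → ℝ => t l) ⁻¹' (Set.Icc a b)ᶜ := by
      ext t
      simp [hA]
    rw [this]
    exact MeasurableSet.iUnion fun l => measurable_pi_apply l measurableSet_Icc.compl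
  -- Each of the `L` coordinates contributes two tails, each a limit tail plus an approximation
  -- error: four terms `η / (8L)`. The other half of `η` is left to the fluctuation of the
  -- frequency.
  have hAp : (dataLaw P PΩ (m n)).real (T (m n) ⁻¹' A) ≤ η / 2 := by
    rw [hA]
    refine (measureReal_exists_notMem_Icc_le PΩ hT (hexch P hP (m n) hn1) a b).trans ?_
    have h1 := abs_le.1 (hna P hP)
    have h2 := abs_le.1 (hnb P hP)
    calc _ ≤ L * (η / (8 * L) + η / (8 * L) + (η / (8 * L) + η / (8 * L))) := by
          gcongr <;> linarith
      _ = η / 2 := by field_simp; ring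
  refine (measureReal_mono ?_).trans (hn P A hAm)
  intro I hI
  rw [Set.mem_ofPred_eq] at hI ⊢
  refine le_trans (le_sub_iff_add_le.2 ?_) (le_abs_self _)
  refine le_trans ?_ ((not_le.1 hI).le.trans (freq_mono fun _ h => hA ▸ h))
  linarith

open Classical in
/-- The rejection probability converges to the level, uniformly over the null hypothesis. -/
theorem tendstoUniformlyOn_rejectionProb {𝒫₀ : Set (ProbabilityMeasure 𝒳)}
    (hT : ∀ n, Measurable (T n))
    (hexch : ∀ P ∈ 𝒫₀, ∀ n, 1 ≤ n → Exchangeable (dataLaw P PΩ n) (T n))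
    (μ₀ : Measure ℝ) [IsProbabilityMeasure μ₀] {C₀ : ℝ}
    (hC₀ : ∀ x y, |cdf μ₀ x - cdf μ₀ y| ≤ C₀ * |x - y|)
    (hstrict : ∀ x y, x < y → cdf μ₀ x < 1 → 0 < cdf μ₀ y → cdf μ₀ x < cdf μ₀ y)
    {S : Fin W → (Fin L → ℝ) → ℝ} (hS : ∀ w, LipschitzWith 1 (S w))
    (hm : Tendsto m atTop atTop) (hmn : Tendsto (fun n => (m n : ℝ) / n) atTop (𝓝 0))
    (hJ : 1 ≤ J) {α : ℝ} (hα : α ∈ Set.Ioo (0 : ℝ) 1)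
    {G : ProbabilityMeasure 𝒳 → Fin W → ProbabilityMeasure ℝ}
    {Q : ProbabilityMeasure 𝒳 → ProbabilityMeasure ℝ} {C : ℝ} (hC : 0 ≤ C)
    (hGC : ∀ P ∈ 𝒫₀, ∀ w x y,
      |cdf (G P w : Measure ℝ) x - cdf (G P w : Measure ℝ) y| ≤ C * |x - y|)
    (hF : ∀ x, TendstoUniformlyOn (fun n P => distFun P PΩ n (fun ω => T n ω 0) x)
      (fun _ => cdf μ₀ x) atTop 𝒫₀)
    (hG : ∀ w x, TendstoUniformlyOn (fun n P => distFun P PΩ n (fun ω => S w (T n ω)) x)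
      (fun P => cdf (G P w : Measure ℝ) x) atTop 𝒫₀)
    (hQ : ∀ x, TendstoUniformlyOn (fun n P => distFun P PΩ n
      (fun ω => maxStat (fun w => cdf (G P w : Measure ℝ)) S (T n ω)) x)
        (fun P => cdf (Q P : Measure ℝ) x) atTop 𝒫₀) :
    TendstoUniformlyOn (fun n P => rejectionProb PΩ T (cdf μ₀) S J α n (m n) P)
      (fun _ => α) atTop 𝒫₀ := by
  have hK := tendsto_div_subsampleSize hm hmn
  have hL : (0 : ℝ) < L := by exact_mod_cast Nat.pos_of_ne_zero (NeZero.ne L)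
  have hL1 : (1 : ℝ) ≤ L := by exact_mod_cast Nat.pos_of_ne_zero (NeZero.ne L)
  have hJ1 : (1 : ℝ) ≤ J := by exact_mod_cast hJ
  have hW : (0 : ℝ) < W := by exact_mod_cast Nat.pos_of_ne_zero (NeZero.ne W)
  have hregF := isRegularFamily_const 𝒫₀ μ₀ hC₀
  have hregG := fun w => isRegularFamily_aggregate PΩ hT hexch μ₀ hF (hS w) (G := fun P => G P w)
    (fun P hP => hGC P hP w) (hG w)
  obtain ⟨hQC, hregQ⟩ := isRegularFamily_maxStat PΩ hT hS hregG hG hQ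
  have hF₀c : Continuous (cdf μ₀) := continuous_of_abs_sub_le hC₀
  have hGc : ∀ P ∈ 𝒫₀, ∀ w, Continuous (cdf (G P w : Measure ℝ)) := fun P hP w =>
    continuous_of_abs_sub_le (hGC P hP w)
  have hQc : ∀ P ∈ 𝒫₀, Continuous (cdf (Q P : Measure ℝ)) := fun P hP =>
    continuous_of_abs_sub_le (hQC P hP)
  have hRm : ∀ P ∈ 𝒫₀, Measurable (maxStat (fun w => cdf (G P w : Measure ℝ)) S) := fun P hP =>
    (continuous_maxStat (hGc P hP) fun w => (hS w).continuous).measurable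
  rw [Metric.tendstoUniformlyOn_iff]
  intro τ hτ
  -- the error budget
  set κ := τ / (4 * (2 * (1 + W * (2 + 2 * C)))) with hκ
  have hκ0 : 0 < κ := by positivity
  have hκτ : 2 * (κ + W * (2 * κ + 2 * C * κ)) = τ / 4 := by
    rw [hκ]
    field_simp
  set c := τ / (4 * (L + 1 + W + 1)) with hc
  have hc0 : 0 < c := by positivity
  have hcτ : L * c + c + W * c + c = τ / 4 := by
    rw [hc]
    field_simp
  -- a compact interval carrying most of the null distribution
  have hq0 : 0 < min (κ / (8 * L)) (1 / 2) := by positivity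
  have hq1 : min (κ / (8 * L)) (1 / 2) ≤ 1 / 2 := min_le_right _ _
  have hrange : ∀ u ∈ Set.Ioo (0 : ℝ) 1, ∃ x, cdf μ₀ x = u := fun u hu =>
    mem_range_of_exists_le_of_exists_ge hF₀c
      (((tendsto_cdf_atBot μ₀).eventually (gt_mem_nhds hu.1)).exists.imp fun _ h => le_of_lt h)
      (((tendsto_cdf_atTop μ₀).eventually (lt_mem_nhds hu.2)).exists.imp fun _ h => le_of_lt h)
  obtain ⟨a, ha⟩ := hrange (min (κ / (8 * L)) (1 / 2)) ⟨hq0, by linarith⟩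
  obtain ⟨b, hb⟩ := hrange (1 - min (κ / (8 * L)) (1 / 2)) ⟨by linarith, by linarith⟩
  obtain ⟨δ, hδ, hq⟩ := exists_quantile_close (monotone_cdf μ₀) hF₀c hstrict
    (a := a) (b := b) (by rw [ha]; exact hq0) (by rw [hb]; linarith) hκ0
  have hinv : Tendsto (fun n => 1 / ((n / m n : ℕ) : ℝ)) atTop (𝓝 0) :=
    ((tendsto_natCast_atTop_atTop (R := ℝ)).comp hK).const_div_atTop 1
  -- the exceptional events
  have hE1 : ∀ᶠ n in atTop, ∀ l, ∀ P ∈ 𝒫₀, (inputLaw P PΩ J n (m n)).real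
      {I | ¬ ∀ x, |ecdf (fun i => subsampleMatrix (T (m n)) I i l) x - cdf μ₀ x| ≤ δ / 2} ≤ c := by
    refine eventually_all.2 fun l => hregF.eventually_measureReal_ecdf_le PΩ hT hm hK hJ
      (V := fun _ t => t l) (fun _ _ => measurable_pi_apply l) (fun x => ?_)
      (by positivity) hc0
    refine (hF x).congr ?_
    filter_upwards [eventually_ge_atTop 1] with n hn P hP
    exact (congrFun (distFun_coord_eq PΩ hT (hexch P hP n hn) l) x).symm
  have hE2 := eventually_measureReal_badRows_le PΩ hT hexch hm hK hJ hF (a := a) (b := b) hκ0 hc0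
    (by rw [ha]; exact min_le_left _ _) (by rw [hb, sub_sub_cancel]; exact min_le_left _ _)
  have hE3 : ∀ᶠ n in atTop, ∀ w, ∀ P ∈ 𝒫₀, (inputLaw P PΩ J n (m n)).real
      {I | ¬ ∀ x, |ecdf (fun i => S w (subsampleMatrix (T (m n)) I i)) x
        - cdf (G P w : Measure ℝ) x| ≤ κ} ≤ c :=
    eventually_all.2 fun w => (hregG w).eventually_measureReal_ecdf_le PΩ hT hm hK hJ
      (V := fun _ => S w) (fun _ _ => (hS w).continuous.measurable) (hG w) hκ0 hc0
  have hE4 := hregQ.eventually_measureReal_ecdf_le PΩ hT hm hK hJ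
      (V := fun P => maxStat (fun w => cdf (G P w : Measure ℝ)) S) hRm hQ hκ0 hc0
  have hfull := hregQ.eventually_forall_abs_sub_le
    (F := fun n P => distFun P PΩ n
      (fun ω => maxStat (fun w => cdf (G P w : Measure ℝ)) S (T n ω)))
    (fun n P => monotone_distFun PΩ P n _) (fun n P => distFun_mem_Icc PΩ P n _) hQ
    (show 0 < τ / 4 by positivity)
  filter_upwards [hE1, hE2, hE3, hE4, hfull, hK.eventually_ge_atTop 1,
    hinv.eventually (gt_mem_nhds (show 0 < δ / 2 by positivity))]
    with n hn1 hn2 hn3 hn4 hn5 hK1 hn6 P hP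
  set μ := inputLaw P PΩ J n (m n) with hμ
  set H : Inputs 𝒳 E J n (m n) → Rows J n (m n) → Fin L → ℝ := subsampleMatrix (T (m n)) with hH
  set R : (Fin L → ℝ) → ℝ := maxStat (fun w => cdf (G P w : Measure ℝ)) S with hRdef
  have hRT : Measurable fun ω => R (T n ω) := (hRm P hP).comp (hT n)
  set rej : Set (Inputs 𝒳 E J n (m n)) :=
    {I | AdaptiveRejects (cdf μ₀) S α (T n I.1) (H I)} with hrej
  set E1 : Set (Inputs 𝒳 E J n (m n)) :=
    ⋃ l, {I | ¬ ∀ x, |ecdf (fun i => H I i l) x - cdf μ₀ x| ≤ δ / 2} with hE1def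
  set E2 : Set (Inputs 𝒳 E J n (m n)) :=
    {I | ¬ freq (fun i => ∃ l, H I i l ∉ Set.Icc a b) ≤ κ} with hE2def
  set E3 : Set (Inputs 𝒳 E J n (m n)) :=
    ⋃ w, {I | ¬ ∀ x, |ecdf (fun i => S w (H I i)) x - cdf (G P w : Measure ℝ) x| ≤ κ} with hE3def
  set E4 : Set (Inputs 𝒳 E J n (m n)) :=
    {I | ¬ ∀ x, |ecdf (fun i => R (H I i)) x - cdf (Q P : Measure ℝ) x| ≤ κ} with hE4def
  have hbad : μ.real (E1 ∪ E2 ∪ E3 ∪ E4) ≤ τ / 4 := by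
    have h1 : μ.real E1 ≤ L * c := (measureReal_iUnion_fintype_le _).trans
      ((Finset.sum_le_sum fun l _ => hn1 l P hP).trans_eq (by simp))
    have h3 : μ.real E3 ≤ W * c := (measureReal_iUnion_fintype_le _).trans
      ((Finset.sum_le_sum fun w _ => hn3 w P hP).trans_eq (by simp))
    have h2 : μ.real E2 ≤ c := hn2 P hP
    have h4 : μ.real E4 ≤ c := hn4 P hP
    have h5 := measureReal_union_le (μ := μ) (E1 ∪ E2 ∪ E3) E4
    have h6 := measureReal_union_le (μ := μ) (E1 ∪ E2) E3
    have h7 := measureReal_union_le (μ := μ) E1 E2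
    linarith
  -- the decision on the good event
  have hgood : ∀ I, I ∉ E1 ∪ E2 ∪ E3 ∪ E4 →
      (I ∈ rej → 1 - α - τ / 4 ≤ cdf (Q P : Measure ℝ) (R (T n I.1))) ∧
      (I ∉ rej → cdf (Q P : Measure ℝ) (R (T n I.1)) ≤ 1 - α + τ / 4) := by
    intro I hI
    simp only [Set.mem_union, not_or] at hI
    obtain ⟨⟨⟨hI1, hI2⟩, hI3⟩, hI4⟩ := hI
    have : Nonempty (Rows J n (m n)) := ⟨(⟨0, hJ⟩, ⟨0, hK1⟩)⟩
    have h1 : ∀ l x, |ecdf (fun i => H I i l) x - cdf μ₀ x| ≤ δ / 2 := fun l => by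
      by_contra h
      exact hI1 (Set.mem_iUnion.2 ⟨l, h⟩)
    have h3 : ∀ w x, |ecdf (fun i => S w (H I i)) x - cdf (G P w : Measure ℝ) x| ≤ κ := fun w => by
      by_contra h
      exact hI3 (Set.mem_iUnion.2 ⟨w, h⟩)
    have hcard : 1 / (2 * (Fintype.card (Rows J n (m n)) : ℝ) * (L : ℝ)) ≤ δ / 2 := by
      refine le_trans ?_ hn6.le
      have hK1' : (1 : ℝ) ≤ (n / m n : ℕ) := by exact_mod_cast hK1
      rw [Fintype.card_prod, Fintype.card_fin, Fintype.card_fin, Nat.cast_mul]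
      refine one_div_le_one_div_of_le (by linarith) ?_
      nlinarith [mul_nonneg (sub_nonneg.2 hJ1) (sub_nonneg.2 hL1)]
    have h := adaptiveRejects_sandwich (F₀ := cdf μ₀) hS (H := H I) (t := T n I.1)
      (G := fun w => cdf (G P w : Measure ℝ)) (Q := cdf (Q P : Measure ℝ)) hκ0.le hκ0.le hC hq
      (fun x => by linarith [abs_ecdf_prod_sub_le fun l => h1 l x])
      (not_not.1 hI2) h3 (not_not.1 hI4) (hGC P hP) (hQC P hP) hα
    rw [hκτ] at h
    exact h
  have hfst : ∀ s : Set ((Fin n → 𝒳) × E), MeasurableSet s →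
      μ.real (Prod.fst ⁻¹' s) = (dataLaw P PΩ n).real s := fun s hs => by
    rw [hμ, inputLaw]
    exact measurePreserving_fst.measureReal_preimage hs.nullMeasurableSet
  have hdist : ∀ x, |(dataLaw P PΩ n).real {ω | R (T n ω) ≤ x} - cdf (Q P : Measure ℝ) x|
      ≤ τ / 4 := fun x => by
    rw [← distFun_eq PΩ P n hRT]
    exact hn5 P hP x
  have hQRm : Measurable fun ω => cdf (Q P : Measure ℝ) (R (T n ω)) :=
    (hQc P hP).measurable.comp hRT
  -- The three quarters of `τ` are the exceptional events, the shift of the level in the sandwich,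
  -- and the distance between the law of `R` and `Q`.
  have hup : μ.real rej ≤ α + 3 * (τ / 4) := by
    have hsub : rej ⊆ (E1 ∪ E2 ∪ E3 ∪ E4) ∪
        Prod.fst ⁻¹' {ω | 1 - α - τ / 4 ≤ cdf (Q P : Measure ℝ) (R (T n ω))} := by
      intro I hI
      by_cases h : I ∈ E1 ∪ E2 ∪ E3 ∪ E4
      · exact Or.inl h
      · exact Or.inr ((hgood I h).1 hI)
    have h1 := (measureReal_mono (μ := μ) hsub).trans (measureReal_union_le _ _)
    rw [hfst _ (measurableSet_le measurable_const hQRm)] at h1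
    have h2 := measureReal_le_transform hRT hdist (hQc P hP) (monotone_cdf _)
      (tendsto_cdf_atBot _) (1 - α - τ / 4)
    rw [min_eq_left (by linarith [hα.1])] at h2
    linarith
  have hlow : α - 3 * (τ / 4) ≤ μ.real rej := by
    -- Covering the whole space, rather than bounding the complement of `rej`, uses only
    -- subadditivity and so avoids measurability of the rejection event.
    have hsub : Set.univ ⊆ (rej ∪ (E1 ∪ E2 ∪ E3 ∪ E4)) ∪
        Prod.fst ⁻¹' {ω | cdf (Q P : Measure ℝ) (R (T n ω)) ≤ 1 - α + τ / 4} := by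
      intro I _
      by_cases h : I ∈ E1 ∪ E2 ∪ E3 ∪ E4
      · exact Or.inl (Or.inr h)
      · by_cases h' : I ∈ rej
        · exact Or.inl (Or.inl h')
        · exact Or.inr ((hgood I h).2 h')
    have h1 := (measureReal_mono (μ := μ) hsub).trans (measureReal_union_le _ _)
    have h3 := measureReal_union_le (μ := μ) rej (E1 ∪ E2 ∪ E3 ∪ E4)
    rw [probReal_univ,
      hfst _ (measurableSet_le hQRm measurable_const)] at h1
    have h2 := measureReal_transform_le hdist (hQc P hP) (monotone_cdf _)
      (tendsto_cdf_atTop _) (1 - α + τ / 4)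
    rw [max_eq_left (by linarith [hα.2])] at h2
    linarith
  have hrp : rejectionProb PΩ T (cdf μ₀) S J α n (m n) P = μ.real rej := rfl
  rw [dist_comm, Real.dist_eq, hrp, abs_lt]
  constructor <;> linarith

end Level

/-! ### Distribution functions of laws with a bounded density -/

section Density

theorem cdf_sub_cdf_eq (μ : Measure ℝ) [IsProbabilityMeasure μ] {x y : ℝ} (h : x ≤ y) :
    cdf μ y - cdf μ x = μ.real (Set.Ioc x y) := by
  rw [cdf_eq_real, cdf_eq_real, ← measureReal_sdiff (Set.Iic_subset_Iic.2 h) measurableSet_Iic,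
    Set.Iic_sdiff_Iic]

theorem abs_cdf_sub_le_of_withDensity {μ : Measure ℝ} [IsProbabilityMeasure μ] {g : ℝ → ℝ≥0∞}
    {C : ℝ≥0} (hμ : μ = volume.withDensity g) (hg : ∀ x, g x ≤ C) (x y : ℝ) :
    |cdf μ x - cdf μ y| ≤ C * |x - y| := by
  wlog hxy : x ≤ y generalizing x y
  · rw [abs_sub_comm, abs_sub_comm x]
    exact this y x (le_of_not_ge hxy)
  rw [abs_sub_comm, abs_sub_comm x, abs_of_nonneg (sub_nonneg.2 (monotone_cdf _ hxy)),
    abs_of_nonneg (sub_nonneg.2 hxy), cdf_sub_cdf_eq μ hxy]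
  refine ENNReal.toReal_le_of_le_ofReal (mul_nonneg C.2 (sub_nonneg.2 hxy)) ?_
  rw [hμ, withDensity_apply _ measurableSet_Ioc, ENNReal.ofReal_mul C.coe_nonneg, ENNReal.ofReal_coe_nnreal,
    ← Real.volume_Ioc]
  exact (setLIntegral_mono measurable_const fun z _ => hg z).trans_eq (setLIntegral_const _ _)

theorem exists_bounded_density_null {F₀ : Measure ℝ} [IsProbabilityMeasure F₀]
    (hF₀ : F₀ = volume.restrict (Set.Icc 0 1) ∨ F₀ = gaussianReal 0 1) :
    ∃ g : ℝ → ℝ≥0∞, F₀ = volume.withDensity g ∧ ∃ C : ℝ≥0, ∀ x, g x ≤ C := by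
  rcases hF₀ with h | h
  · refine ⟨(Set.Icc 0 1).indicator 1, by rw [h, withDensity_indicator_one measurableSet_Icc], 1,
      fun x => ?_⟩
    exact (Set.indicator_le_self' (fun _ _ => bot_le) x).trans (by simp)
  · refine ⟨gaussianPDF 0 1, by rw [h, gaussianReal_of_var_ne_zero 0 one_ne_zero],
      ((√(2 * Real.pi * 1))⁻¹).toNNReal, fun x => ?_⟩
    refine ENNReal.ofReal_le_ofReal ?_
    rw [gaussianPDFReal]
    refine mul_le_of_le_one_right (by positivity) (Real.exp_le_one_iff.2 ?_)
    exact div_nonpos_of_nonpos_of_nonneg (neg_nonpos.2 (sq_nonneg _)) (by positivity)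

/-- The two side conditions exclude the flat parts of the uniform distribution function, leaving a
nondegenerate interval inside `[0, 1]`. In the normal case Lebesgue measure is absolutely continuous
with respect to the law. -/
theorem cdf_null_strict {F₀ : Measure ℝ} [IsProbabilityMeasure F₀]
    (hF₀ : F₀ = volume.restrict (Set.Icc 0 1) ∨ F₀ = gaussianReal 0 1) (x y : ℝ) (hxy : x < y)
    (hx : cdf F₀ x < 1) (hy : 0 < cdf F₀ y) : cdf F₀ x < cdf F₀ y := by
  rw [← sub_pos, cdf_sub_cdf_eq F₀ hxy.le]
  refine ENNReal.toReal_pos ?_ (measure_ne_top _ _)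
  rcases hF₀ with h | h
  · have hx1 : x < 1 := by
      by_contra! hcon
      have : F₀ (Set.Iic x) = 1 := by
        rw [h, Measure.restrict_apply measurableSet_Iic,
          Set.inter_eq_right.2 fun z hz => hz.2.trans hcon]
        simp
      rw [cdf_eq_real, Measure.real, this] at hx
      simp at hx
    have hy0 : 0 < y := by
      by_contra! hcon
      have : F₀ (Set.Iic y) = 0 := by
        rw [h, Measure.restrict_apply measurableSet_Iic]
        refine measure_mono_null (t := {0}) (fun z hz => ?_) (by simp)
        exact le_antisymm (hz.1.trans hcon) hz.2.1
      rw [cdf_eq_real, Measure.real, this] at hy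
      simp at hy
    have hlt : max x 0 < min y 1 := max_lt (lt_min hxy hx1) (lt_min hy0 one_pos)
    rw [h, Measure.restrict_apply measurableSet_Ioc]
    have hsub : Set.Ioo (max x 0) (min y 1) ⊆ Set.Ioc x y ∩ Set.Icc 0 1 := fun z hz =>
      ⟨⟨(le_max_left _ _).trans_lt hz.1, hz.2.le.trans (min_le_left _ _)⟩,
        (le_max_right _ _).trans hz.1.le, hz.2.le.trans (min_le_right _ _)⟩
    refine (lt_of_lt_of_le ?_ (measure_mono hsub)).ne'
    rw [Real.volume_Ioo]
    exact ENNReal.ofReal_pos.2 (sub_pos.2 hlt)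
  · intro h0
    rw [h] at h0
    have h1 := gaussianReal_absolutelyContinuous' 0 one_ne_zero h0
    rw [Real.volume_Ioc, ENNReal.ofReal_eq_zero] at h1
    linarith

/-- The exact probability integral transform: with error `δ = 0`, the value falls in `(u - e, u]`
with probability at most `e`, for every `e > 0`. -/
theorem measure_transform_eq_zero (μ : Measure ℝ) [IsProbabilityMeasure μ]
    (hc : Continuous (cdf μ)) (u : ℝ) : μ {y | cdf μ y = u} = 0 := by
  rw [← measureReal_eq_zero_iff]
  refine le_antisymm (le_of_forall_pos_le_add fun e he => ?_) measureReal_nonneg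
  have h := measureReal_transform_mem_Ioc_le (μ := μ) (Y := id) (G := cdf μ) (δ := 0) measurable_id
    (fun x => by rw [cdf_eq_real]; simp [Set.Iic]) hc (monotone_cdf _)
    (tendsto_cdf_atBot _) (tendsto_cdf_atTop _) (show u - e ≤ u by linarith)
  refine (measureReal_mono (fun y (hy : _ = u) => ?_)).trans (h.trans (by linarith))
  exact ⟨show u - e < cdf μ y by rw [hy]; linarith, le_of_eq hy⟩

end Density

/-! ### Convergence in distribution -/

section WeakLimits

variable {𝒳 E : Type*} [MeasurableSpace 𝒳] [MeasurableSpace E] (PΩ : Measure E)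
  [IsProbabilityMeasure PΩ] {P : ProbabilityMeasure 𝒳}

theorem tendsto_distFun_of_tendstoInDistribution {Ω : Type*} [MeasurableSpace Ω]
    {μ : Measure Ω} [IsProbabilityMeasure μ] {Y : ∀ n, (Fin n → 𝒳) × E → ℝ} {Z : Ω → ℝ}
    (h : TendstoInDistribution Y atTop Z (fun n => dataLaw P PΩ n) μ) (x : ℝ)
    (hx : μ.map Z {x} = 0) :
    Tendsto (fun n => distFun P PΩ n (Y n) x) atTop (𝓝 (cdf (μ.map Z) x)) := by
  have := Measure.isProbabilityMeasure_map h.aemeasurable_limit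
  have h1 := ProbabilityMeasure.tendsto_measure_of_null_frontier_of_tendsto' h.tendsto
    (E := Set.Iic x) (by rw [frontier_Iic]; exact hx)
  have h2 := (ENNReal.tendsto_toReal (show μ.map Z (Set.Iic x) ≠ ∞ from measure_ne_top _ _)).comp h1
  rw [cdf_eq_real]
  refine h2.congr fun n => ?_
  have := Measure.isProbabilityMeasure_map (h.forall_aemeasurable n)
  rw [distFun, cdf_eq_real]
  rfl

variable {L W : ℕ} [NeZero W] {T : ∀ n, (Fin n → 𝒳) × E → Fin L → ℝ}
  {S : Fin W → (Fin L → ℝ) → ℝ}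

/-- `G w` is the `w`-th marginal of the limit vector and `Q` the law of the maximum of its
transformed coordinates, reached by continuous mapping. `Q` has no atoms, because a maximum equal to
`x` forces some transformed coordinate to equal `x`; hence the distribution functions converge at
every point. -/
theorem JointlyStable.exists_limits (h : JointlyStable PΩ T S P) :
    ∃ (G : Fin W → ProbabilityMeasure ℝ) (Q : ProbabilityMeasure ℝ) (C : ℝ), 0 ≤ C ∧
      (∀ w x y, |cdf (G w : Measure ℝ) x - cdf (G w : Measure ℝ) y| ≤ C * |x - y|) ∧
      (∀ w x, Tendsto (fun n => distFun P PΩ n (fun ω => S w (T n ω)) x) atTop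
        (𝓝 (cdf (G w : Measure ℝ) x))) ∧
      ∀ x, Tendsto (fun n => distFun P PΩ n
        (fun ω => maxStat (fun w => cdf (G w : Measure ℝ)) S (T n ω)) x) atTop
          (𝓝 (cdf (Q : Measure ℝ) x)) := by
  obtain ⟨ν, hν, hg⟩ := h
  choose g hgm hgν C hgC using hg
  let G : Fin W → ProbabilityMeasure ℝ := fun w =>
    ν.map (f := fun s => s w) (measurable_pi_apply w).aemeasurable
  have hGν : ∀ w, (G w : Measure ℝ) = (ν : Measure (Fin W → ℝ)).map fun s => s w := fun w => rfl
  have hLip : ∀ w x y, |cdf (G w : Measure ℝ) x - cdf (G w : Measure ℝ) y| ≤ C w * |x - y| :=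
    fun w => abs_cdf_sub_le_of_withDensity ((hGν w).trans (hgν w)) (hgC w)
  have hGc : ∀ w, Continuous (cdf (G w : Measure ℝ)) := fun w => continuous_of_abs_sub_le (hLip w)
  let r : (Fin W → ℝ) → ℝ := fun s =>
    Finset.univ.sup' Finset.univ_nonempty fun w => cdf (G w : Measure ℝ) (s w)
  have hr : Continuous r :=
    Continuous.finset_sup'_apply _ fun w _ => (hGc w).comp (continuous_apply w)
  refine ⟨G, ν.map (f := r) hr.measurable.aemeasurable, ∑ w, C w, by positivity,
    fun w x y => ?_, fun w x => ?_, fun x => ?_⟩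
  · refine (hLip w x y).trans (mul_le_mul_of_nonneg_right ?_ (abs_nonneg _))
    exact Finset.single_le_sum (f := fun w => (C w : ℝ)) (fun w _ => (C w).2) (Finset.mem_univ w)
  · refine tendsto_distFun_of_tendstoInDistribution PΩ
      (hν.continuous_comp (g := fun s : Fin W → ℝ => s w) (continuous_apply w)) x ?_
    change (ν : Measure (Fin W → ℝ)).map (fun s => s w) {x} = 0
    rw [hgν w]
    exact withDensity_absolutelyContinuous _ _ (by simp)
  · refine tendsto_distFun_of_tendstoInDistribution PΩ (hν.continuous_comp hr) x ?_
    change (ν : Measure (Fin W → ℝ)).map r {x} = 0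
    rw [Measure.map_apply hr.measurable (measurableSet_singleton x)]
    refine measure_mono_null (t := ⋃ w, (fun s : Fin W → ℝ => s w) ⁻¹'
      {y | cdf (G w : Measure ℝ) y = x}) (fun s hs => ?_) (measure_iUnion_null fun w => ?_)
    · obtain ⟨w, -, hw⟩ := Finset.exists_mem_eq_sup' Finset.univ_nonempty
        fun w => cdf (G w : Measure ℝ) (s w)
      exact Set.mem_iUnion.2 ⟨w, hw.symm.trans hs⟩
    · rw [← Measure.map_apply (measurable_pi_apply w)
        (measurableSet_eq_fun (hGc w).measurable measurable_const), ← hGν]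
      exact measure_transform_eq_zero _ (hGc w) x

end WeakLimits

end RankSub

/-! ### The theorem: pointwise and uniform asymptotic level -/

open RankSub in
theorem theorem2 {𝒳 E : Type*} [MeasurableSpace 𝒳] [MeasurableSpace E]
    -- the null hypothesis and the law of the external randomness
    (𝒫₀ : Set (ProbabilityMeasure 𝒳)) (PΩ : Measure E) [IsProbabilityMeasure PΩ]
    -- the single-split statistics
    {L W : ℕ} [NeZero L] [NeZero W]
    (T : ∀ n, (Fin n → 𝒳) × E → Fin L → ℝ) (hT : ∀ n, Measurable (T n))
    (hexch : ∀ P ∈ 𝒫₀, ∀ n, 1 ≤ n → Exchangeable (dataLaw P PΩ n) (T n))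
    -- the asymptotic null distribution
    (F₀ : Measure ℝ) [IsProbabilityMeasure F₀]
    (hF₀ : F₀ = volume.restrict (Set.Icc 0 1) ∨ F₀ = gaussianReal 0 1)
    (hpivot : ∀ P ∈ 𝒫₀, TendstoInDistribution (fun n ω => T n ω 0) atTop (id : ℝ → ℝ)
      (fun n => dataLaw P PΩ n) F₀)
    -- the aggregation functions, Lipschitz for the sup norm
    (S : Fin W → (Fin L → ℝ) → ℝ) (hS : ∀ w, LipschitzWith 1 (S w))
    -- the subsample size and the number of permutations
    (m : ℕ → ℕ) (hm : Tendsto m atTop atTop)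
    (hmn : Tendsto (fun n => (m n : ℝ) / n) atTop (𝓝 0))
    (J : ℕ) (hJ : 1 ≤ J)
    (α : ℝ) (hα : α ∈ Set.Ioo (0 : ℝ) 1) :
    -- pointwise
    ((∀ P ∈ 𝒫₀, JointlyStable PΩ T S P) →
      ∀ P ∈ 𝒫₀, Tendsto (fun n => rejectionProb PΩ T (cdf F₀) S J α n (m n) P) atTop (𝓝 α)) ∧
    -- uniform
    (∀ (G : ProbabilityMeasure 𝒳 → Fin W → ProbabilityMeasure ℝ)
        (g : ProbabilityMeasure 𝒳 → Fin W → ℝ → ℝ≥0∞)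
        (Q : ProbabilityMeasure 𝒳 → ProbabilityMeasure ℝ),
      (∀ P ∈ 𝒫₀, ∀ w, Measurable (g P w) ∧
        (G P w : Measure ℝ) = volume.withDensity (g P w)) →
      (∃ C : ℝ≥0, ∀ P ∈ 𝒫₀, ∀ w x, g P w x ≤ C) →
      (∀ x, TendstoUniformlyOn (fun n P => distFun P PΩ n (fun ω => T n ω 0) x)
        (fun _ => cdf F₀ x) atTop 𝒫₀) →
      (∀ w x, TendstoUniformlyOn (fun n P => distFun P PΩ n (fun ω => S w (T n ω)) x)
        (fun P => cdf (G P w : Measure ℝ) x) atTop 𝒫₀) →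
      (∀ x, TendstoUniformlyOn
        (fun n P => distFun P PΩ n
          (fun ω => maxStat (fun w => cdf (G P w : Measure ℝ)) S (T n ω)) x)
        (fun P => cdf (Q P : Measure ℝ) x) atTop 𝒫₀) →
      TendstoUniformlyOn (fun n P => rejectionProb PΩ T (cdf F₀) S J α n (m n) P)
        (fun _ => α) atTop 𝒫₀) := by
  obtain ⟨g₀, hg₀, C₀, hC₀⟩ := exists_bounded_density_null hF₀
  have hLip₀ := abs_cdf_sub_le_of_withDensity hg₀ hC₀
  have hstrict := cdf_null_strict hF₀
  refine ⟨fun hstable P hP => ?_, fun G g Q hGg hgC hF hG hQ => ?_⟩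
  · obtain ⟨G, Q, C, hC, hGC, hG, hQ⟩ := (hstable P hP).exists_limits
    have hexch' : ∀ P' ∈ ({P} : Set (ProbabilityMeasure 𝒳)), ∀ n, 1 ≤ n →
        Exchangeable (dataLaw P' PΩ n) (T n) := by
      rintro P' rfl
      exact hexch P' hP
    -- Uniform convergence over the singleton `{P}` is pointwise convergence, so the uniform
    -- statement applies with constant `G` and `Q`.
    rw [← tendstoUniformlyOn_singleton_iff_tendsto (f := fun _ => α)]
    refine tendstoUniformlyOn_rejectionProb PΩ hT hexch' F₀ hLip₀ hstrict hS hm hmn hJ hα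
      (G := fun _ => G) (Q := fun _ => Q) hC (fun _ _ => hGC) (fun x => ?_) (fun w x => ?_)
      (fun x => ?_)
    · rw [tendstoUniformlyOn_singleton_iff_tendsto]
      have h := tendsto_distFun_of_tendstoInDistribution PΩ (hpivot P hP) x (by
        rw [Measure.map_id, hg₀]
        exact withDensity_absolutelyContinuous _ _ (by simp))
      rwa [Measure.map_id] at h
    · rw [tendstoUniformlyOn_singleton_iff_tendsto]
      exact hG w x
    · rw [tendstoUniformlyOn_singleton_iff_tendsto]
      exact hQ x
  · obtain ⟨C, hC⟩ := hgC
    exact tendstoUniformlyOn_rejectionProb PΩ hT hexch F₀ hLip₀ hstrict hS hm hmn hJ hα C.2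
      (fun P hP w => abs_cdf_sub_le_of_withDensity (hGg P hP w).2 (hC P hP w)) hF hG hQ
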